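/- Let $d\ge 0$ be an integer, let $\mathbb S^d=\{x\in\mathbb R^{d+1}:\|x\|=1\}$ and let $\mu$ be the normalized surface measure on $\mathbb S^d$. For $L\in\mathbb N_0$ let $\mathscr P_L^d$ be the space spanned by the spherical harmonics (restrictions to $\mathbb S^d$ of harmonic homogeneous polynomials) of degree at most $L$. A finite non-empty set $\mathcal X=\{x_1,\dots,x_n\}\subset\mathbb S^d$ of $n$ distinct points is a spherical $t$-design if $\frac1n\sum_{i=1}^n p(x_i)=\int_{\mathbb S^d}p\,d\mu$ for all polynomials $p$ in $d+1$ variables of total degree $\le t$. For statistical experiments $\mathcal E=(P_\theta)_{\theta\in\Theta}$, $\mathcal F=(Q_\theta)_{\theta\in\Theta}$ with the same parameter space let $\Delta(\mathcal E,\mathcal F)=\max\{\delta(\mathcal E,\mathcal F),\delta(\mathcal F,\mathcal E)\}$ be the Le Cam distance, where $\delta(\mathcal E,\mathcal F)=\inf_K\sup_{\theta\in\Theta}V(KP_\theta,Q_\theta)$, the infimum is over Markov kernels $K$ between the sample spaces, and $V(P,Q)=\sup_A|P(A)-Q(A)|$ is the total variation distance. Let $\Phi$ be the standard Gaussian distribution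 function, with $\Phi(-\infty)=0$. Let $\Theta$ be a class of functions $f:\mathbb S^d\to\mathbb R$ that are square-integrable with respect to $\mu$, let $\sigma>0$, let $\psi_1,\dots,\psi_m:\mathbb S^d\to\mathbb R$ be functions with $\operatorname{span}\{\psi_1,\dots,\psi_m\}\subseteq\mathscr P_L^d$ (not necessarily orthonormal or linearly independent), and put $$\tilde f_m=\sum_{j=1}^m\tilde\beta_j\psi_j,\qquad \tilde\beta_j=\frac1n\sum_{i=1}^n f(x_i)\psi_j(x_i).$$ Consider three experiments with parameter $f\in\Theta$: the regression experiment $\mathcal F_n$ with observations $Z_i=f(x_i)+\sigma\varepsilon_i$, $i=1,\dots,n$, where the $\varepsilon_i$ are i.i.d. standard Gaussian; the white noise experiment $\mathcal G_n$ given by $dZ=f\,d\mu+\frac{\sigma}{\sqrt n}\,dW$; and the intermediate experiment $\widetilde{\mathcal G}_n$ given by $d\widetilde Z=\tilde f_m\,d\mu+\frac{\sigma}{\sqrt n}\,dW$. Here $dW$ is standard Gaussian white noise on $\mathbb S^d$, and observing $dZ=b\,d\mu+\tau\,dW$ means observing the Gaussian process $g\mapsto\int bg\,d\mu+\tau\int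 g\,dW$ indexed by $g\in L^2(\mathbb S^d,\mu)$, where $g\mapsto\int g\,dW$ is centred Gaussian with covariance $\langle g,h\rangle_{L^2}$. Let $P_f$ and $P_{\tilde f_m}$ be the distributions of the observations in $\mathcal G_n$ and $\widetilde{\mathcal G}_n$, respectively. **Theorem.** Suppose that $\mathcal X$ is a spherical $t$-design with $t\ge 2L$. Then $$\Delta(\mathcal F_n,\mathcal G_n)\le\Delta_1+\Delta_2,\qquad \Delta_1=\Delta(\mathcal F_n,\widetilde{\mathcal G}_n),\quad \Delta_2=\Delta(\widetilde{\mathcal G}_n,\mathcal G_n),$$ where, with a universal numerical constant $C$ (independent of all the data above), $$\Delta_1\le 1-2\Phi\Bigl(-\tfrac1{2\sigma}\sqrt{\sup_{f\in\Theta}\textstyle\sum_{i=1}^n(\tilde f_m(x_i)-f(x_i))^2}\Bigr)\le C\,\sigma^{-1}\sup_{f\in\Theta}\sqrt{\textstyle\sum_{i=1}^n(\tilde f_m(x_i)-f(x_i))^2}$$ and $$\Delta_2\le\sup_{f\in\Theta}V(P_{\tilde f_m},P_f)=1-2\Phi\Bigl(-\tfrac{\sqrt n}{2\sigma}\sup_{f\in\Theta}\|f-\tilde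 f_m\|_{L^2}\Bigr)\le C\,\sigma^{-1}\sqrt n\,\sup_{f\in\Theta}\|f-\tilde f_m\|_{L^2}.$$ Suprema are taken in $[0,\infty]$, and the supremum over the empty class is $0$. -/

import Mathlib

open MeasureTheory ProbabilityTheory Filter Topology
open scoped ENNReal NNReal RealInnerProductSpace

/-! ### Statistical experiments and the Le Cam distance -/

/-- A statistical experiment with parameter space `Θ`: a measurable sample space together with a
family of probability measures on it that is indexed by `Θ`. -/
structure StatExperiment (Θ : Type*) where
  Sample : Type
  [measurableSpace : MeasurableSpace Sample]
  law : Θ → Measure Sample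
  [isProbabilityMeasure : ∀ θ, IsProbabilityMeasure (law θ)]

attribute [instance] StatExperiment.measurableSpace StatExperiment.isProbabilityMeasure

/-- Total variation distance `sup_A |P(A) - Q(A)|`. -/
noncomputable def tvDist {X : Type*} [MeasurableSpace X] (P Q : Measure X) : ℝ≥0∞ :=
  ⨆ (A : Set X) (_ : MeasurableSet A), ENNReal.ofReal |P.real A - Q.real A|

/-- The deficiency `δ(E, F) = inf_K sup_θ V(K P_θ^E, P_θ^F)`, the infimum being over all Markov
kernels `K` from the sample space of `E` to the sample space of `F`. -/
noncomputable def deficiency {Θ : Type*} (E F : StatExperiment Θ) : ℝ≥0∞ :=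
  ⨅ (K : Kernel E.Sample F.Sample) (_ : IsMarkovKernel K), ⨆ θ, tvDist (K ∘ₘ E.law θ) (F.law θ)

/-- The Le Cam distance. -/
noncomputable def leCamDist {Θ : Type*} (E F : StatExperiment Θ) : ℝ≥0∞ :=
  max (deficiency E F) (deficiency F E)

/-! ### The sphere, spherical harmonics and spherical designs -/

/-- The unit sphere `S^d` of `ℝ^(d+1)`. -/
abbrev UnitSphere (d : ℕ) : Type := Metric.sphere (0 : EuclideanSpace ℝ (Fin (d + 1))) 1

/-- Normalized surface measure on `S^d`. -/
noncomputable def sphereMeasure (d : ℕ) : Measure (UnitSphere d) :=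
  ((volume : Measure (EuclideanSpace ℝ (Fin (d + 1)))).toSphere Set.univ)⁻¹ •
    (volume : Measure (EuclideanSpace ℝ (Fin (d + 1)))).toSphere

instance isProbabilityMeasure_sphereMeasure (d : ℕ) : IsProbabilityMeasure (sphereMeasure d) :=
  ⟨by
    rw [sphereMeasure, Measure.smul_apply, smul_eq_mul]
    exact ENNReal.inv_mul_cancel
      (by rw [Ne, Measure.measure_univ_eq_zero]; exact Measure.toSphere_ne_zero _)
      (measure_ne_top _ _)⟩

/-- Restriction of polynomials in `d + 1` variables to `S^d`. -/
noncomputable def polyToSphere (d : ℕ) :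
    MvPolynomial (Fin (d + 1)) ℝ →ₗ[ℝ] (UnitSphere d → ℝ) where
  toFun p y := MvPolynomial.eval (fun i => (y : EuclideanSpace ℝ (Fin (d + 1))) i) p
  map_add' p q := by ext y; simp
  map_smul' c p := by ext y; simp [MvPolynomial.smul_eval]

/-- The Euclidean Laplacian `∑ i, ∂²/∂X_i²` on polynomials in `d + 1` variables. -/
noncomputable def polyLaplacian (d : ℕ) :
    MvPolynomial (Fin (d + 1)) ℝ →ₗ[ℝ] MvPolynomial (Fin (d + 1)) ℝ :=
  ∑ i, (MvPolynomial.pderiv i).toLinearMap ∘ₗ (MvPolynomial.pderiv i).toLinearMap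

/-- The space `H_ℓ` of spherical harmonics of degree `ℓ`: the restrictions to `S^d` of the
harmonic homogeneous polynomials of degree `ℓ`. -/
noncomputable def sphericalHarmonics (d l : ℕ) : Submodule ℝ (UnitSphere d → ℝ) :=
  (MvPolynomial.homogeneousSubmodule (Fin (d + 1)) ℝ l ⊓ LinearMap.ker (polyLaplacian d)).map
    (polyToSphere d)

/-- The space `P_L` spanned by the spherical harmonics of degree at most `L`. -/
noncomputable def sphericalPolynomials (d L : ℕ) : Submodule ℝ (UnitSphere d → ℝ) :=
  ⨆ l ∈ Finset.range (L + 1), sphericalHarmonics d l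

/-- The points `x_1, …, x_n` are pairwise distinct and form a spherical `t`-design. -/
structure IsSphericalDesign {d n : ℕ} (t : ℕ) (x : Fin n → UnitSphere d) : Prop where
  nonempty : 0 < n
  injective : Function.Injective x
  cubature : ∀ p : MvPolynomial (Fin (d + 1)) ℝ, p.totalDegree ≤ t →
    (1 / (n : ℝ)) * ∑ i, polyToSphere d p (x i) = ∫ y, polyToSphere d p y ∂sphereMeasure d

/-! ### Empirical approximation -/

/-- The empirical inner product `⟨f, g⟩_n = n⁻¹ ∑ i, f (x_i) g (x_i)`. -/
noncomputable def empInner {d n : ℕ} (x : Fin n → UnitSphere d) (f g : UnitSphere d → ℝ) : ℝ :=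
  (1 / (n : ℝ)) * ∑ i, f (x i) * g (x i)

/-- The empirical approximation `∑ j, ⟨f, ψ_j⟩_n ψ_j` of `f`. -/
noncomputable def empApprox {d n m : ℕ} (x : Fin n → UnitSphere d)
    (ψ : Fin m → UnitSphere d → ℝ) (f : UnitSphere d → ℝ) : UnitSphere d → ℝ :=
  fun y => ∑ j, empInner x f (ψ j) * ψ j y

/-! ### Gaussian white noise -/

/-- `P` is the law, on `ℝ^H` with the product σ-algebra, of a centred Gaussian process indexed by
the Hilbert space `H` with covariance structure `⟪g, h⟫`. -/
structure IsIsonormalLaw {H : Type*} [NormedAddCommGroup H] [InnerProductSpace ℝ H]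
    (P : Measure (H → ℝ)) : Prop where
  gaussian : IsGaussianProcess (fun (h : H) (w : H → ℝ) => w h) P
  mean : ∀ h : H, ∫ w, w h ∂P = 0
  cov : ∀ g h : H, cov[fun w => w g, fun w => w h; P] = ⟪g, h⟫

theorem map_gaussian_of_tendsto {Ω : Type*} [MeasurableSpace Ω] {P : Measure Ω}
    [IsProbabilityMeasure P] {X : ℕ → Lp ℝ 2 P} {Y : Lp ℝ 2 P} (h : Tendsto X atTop (𝓝 Y))
    (hX : ∀ n, P.map (X n) = gaussianReal 0 (‖X n‖ ^ 2).toNNReal) :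
    P.map Y = gaussianReal 0 (‖Y‖ ^ 2).toNNReal := by
  have hm : ∀ Z : Lp ℝ 2 P, AEMeasurable Z P := fun Z => (Lp.aestronglyMeasurable Z).aemeasurable
  have hd : TendstoInDistribution (fun n => (X n : Ω → ℝ)) atTop (Y : Ω → ℝ) (fun _ => P) P :=
    (tendstoInMeasure_of_tendsto_Lp h).tendstoInDistribution (fun n => hm _)
  have := Measure.isProbabilityMeasure_map (hm Y)
  refine Measure.ext_of_charFun (funext fun t => ?_)
  have h1 := (ProbabilityMeasure.tendsto_iff_tendsto_charFun.1 hd.tendsto) t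
  have h2 : Tendsto (fun n => charFun (P.map (X n)) t) atTop
      (𝓝 (charFun (gaussianReal 0 (‖Y‖ ^ 2).toNNReal) t)) := by
    simp only [hX, charFun_gaussianReal, Real.coe_toNNReal _ (sq_nonneg _)]
    have h3 : Tendsto (fun n => ‖X n‖) atTop (𝓝 ‖Y‖) := h.norm
    have hc : Continuous fun r : ℝ =>
        Complex.exp (t * (0 : ℝ) * Complex.I - ((r ^ 2 : ℝ) : ℂ) * t ^ 2 / 2) := by fun_prop
    exact (hc.tendsto _).comp h3
  exact tendsto_nhds_unique h1 h2

theorem exists_isIsonormalLaw (H : Type*) [NormedAddCommGroup H] [InnerProductSpace ℝ H]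
    [CompleteSpace H] : ∃ P : Measure (H → ℝ), IsIsonormalLaw P := by
  classical
  obtain ⟨s, b, -⟩ := exists_hilbertBasis ℝ H
  let P₀ : Measure (s → ℝ) := Measure.infinitePi fun _ => gaussianReal 0 1
  have hmem : ∀ i : s, MemLp (fun ω : s → ℝ => ω i) 2 P₀ := fun i =>
    MemLp.comp_measurePreserving (g := id) (memLp_id_gaussianReal 2)
      (measurePreserving_eval_infinitePi (fun _ : s => gaussianReal 0 1) i)
  have hind : iIndepFun (fun (i : s) (ω : s → ℝ) => ω i) P₀ :=
    iIndepFun_infinitePi (X := fun _ x => x) (fun _ => measurable_id)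
  have hlaw : ∀ i : s, P₀.map (fun ω => ω i) = gaussianReal 0 1 := fun i =>
    Measure.infinitePi_map_eval _ i
  have hmean : ∀ i : s, ∫ ω, ω i ∂P₀ = 0 := fun i => by
    have := integral_map (μ := P₀) (φ := fun ω => ω i) (f := fun x : ℝ => x)
      (measurable_pi_apply i).aemeasurable (by fun_prop)
    rw [← this, hlaw]; simp
  have hsq : ∀ i : s, ∫ ω, ω i * ω i ∂P₀ = 1 := fun i => by
    have h1 : Var[fun ω => ω i; P₀] = 1 := by
      have := variance_map (μ := P₀) (X := fun x : ℝ => x) (Y := fun ω => ω i) (by fun_prop)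
        (measurable_pi_apply i).aemeasurable
      rw [hlaw] at this
      simpa [Function.comp_def] using this.symm
    rw [variance_eq_sub (hmem i), hmean] at h1
    simpa [pow_two] using h1
  let e : s → Lp ℝ 2 P₀ := fun i => (hmem i).toLp
  have he : Orthonormal ℝ e := by
    rw [orthonormal_iff_ite]
    intro i j
    have : ⟪e i, e j⟫ = ∫ ω, ω i * ω j ∂P₀ := by
      rw [L2.inner_def]
      refine integral_congr_ae ?_
      filter_upwards [(hmem i).coeFn_toLp, (hmem j).coeFn_toLp] with ω h1 h2
      simp only [e, h1, h2]
      simp [mul_comm]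
    rw [this]
    split_ifs with hij
    · subst hij; exact hsq i
    · have := (hind.indepFun hij).integral_fun_mul_eq_mul_integral
        (hmem i).aestronglyMeasurable (hmem j).aestronglyMeasurable
      rw [this, hmean]; simp
  let V := he.orthogonalFamily
  let U : H →ₗᵢ[ℝ] Lp ℝ 2 P₀ := V.linearIsometry.comp b.repr.toLinearIsometry
  let G : Set (Lp ℝ 2 P₀) := {X | P₀.map X = gaussianReal 0 (‖X‖ ^ 2).toNNReal}
  have hG : IsClosed G := by
    refine IsSeqClosed.isClosed fun X Y hX hXY => ?_
    exact map_gaussian_of_tendsto hXY hX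
  have hsum : ∀ (t : Finset s) (c : s → ℝ), (∑ i ∈ t, c i • e i) ∈ G := by
    intro t c
    set X : Lp ℝ 2 P₀ := ∑ i ∈ t, c i • e i with hXdef
    have hXae : (X : (s → ℝ) → ℝ) =ᵐ[P₀] fun ω => ∑ i : t, c i * ω i := by
      have h1 := Lp.coeFn_finsetSum t (fun i => c i • e i)
      have h2 : ∀ᵐ ω ∂P₀, ∀ i ∈ t, (c i • e i : Lp ℝ 2 P₀) ω = c i * ω i := by
        refine (Finset.eventually_all t).2 fun i _ => ?_
        filter_upwards [Lp.coeFn_smul (c i) (e i), (hmem i).coeFn_toLp] with ω h3 h4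
        rw [h3, Pi.smul_apply, h4, smul_eq_mul]
      filter_upwards [h1, h2] with ω h3 h4
      rw [h3, Finset.sum_apply, Finset.sum_congr rfl h4, ← Finset.sum_coe_sort]
    have hg : HasGaussianLaw (X : (s → ℝ) → ℝ) P₀ := by
      refine HasGaussianLaw.congr ?_ hXae.symm
      refine iIndepFun.hasGaussianLaw_fun_sum (X := fun (i : t) (ω : s → ℝ) => c i * ω i) ?_ ?_
      · intro i
        have : HasGaussianLaw (fun ω : s → ℝ => ω i) P₀ := ⟨by rw [hlaw]; infer_instance⟩
        exact this.fun_smul (c i)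
      · exact (hind.precomp (g := fun i : t => (i : s)) Subtype.val_injective).comp
          (fun i x => c i * x) (fun i => by fun_prop)
    have hm : ∫ ω, X ω ∂P₀ = 0 := by
      rw [integral_congr_ae hXae, integral_finsetSum (μ := P₀) (Finset.univ : Finset t)
        (f := fun (i : t) (ω : s → ℝ) => c i * ω i)
        (fun i _ => ((hmem i).integrable one_le_two).const_mul _)]
      simp [integral_const_mul, hmean]
    have hv : Var[X; P₀] = ‖X‖ ^ 2 := by
      rw [variance_eq_sub (Lp.memLp X), hm, ← real_inner_self_eq_norm_sq, L2.inner_def]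
      simp [pow_two]
    have := hg.map_eq_gaussianReal
    rwa [hm, hv] at this
  have hU : ∀ h, P₀.map (U h) = gaussianReal 0 (‖h‖ ^ 2).toNNReal := by
    intro h
    have hs := V.hasSum_linearIsometry (b.repr h)
    have h1 : U h ∈ G := by
      refine hG.mem_of_tendsto hs (Eventually.of_forall fun t => ?_)
      exact hsum t _
    have h2 : P₀.map (U h) = gaussianReal 0 (‖U h‖ ^ 2).toNNReal := h1
    rwa [U.norm_map] at h2
  have hUm : ∀ h, Measurable (U h : (s → ℝ) → ℝ) := fun h => (Lp.stronglyMeasurable _).measurable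
  have hU0 : ∀ h, ∫ ω, U h ω ∂P₀ = 0 := fun h => by
    have := integral_map (μ := P₀) (φ := (U h : (s → ℝ) → ℝ)) (f := fun x : ℝ => x)
      (hUm h).aemeasurable (by fun_prop)
    rw [← this, hU]; simp
  let T : (s → ℝ) → H → ℝ := fun ω h => U h ω
  have hT : Measurable T := measurable_pi_lambda _ hUm
  refine ⟨P₀.map T, ⟨⟨fun I => ⟨⟨fun L => ?_⟩⟩⟩, fun h => ?_, fun g h => ?_⟩⟩
  · have hr : Measurable fun w : H → ℝ => I.restrict w := by fun_prop
    have hre : (fun w : H → ℝ => I.restrict (fun h => w h)) = fun w => I.restrict w := rfl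
    rw [hre, Measure.map_map hr hT]
    let k : H := ∑ i : I, L (Pi.single i 1) • (i : H)
    have hk : (fun ω => L (I.restrict (T ω))) =ᵐ[P₀] (U k : (s → ℝ) → ℝ) := by
      have h0 : U k = ∑ i : I, L (Pi.single i 1) • U (i : H) := by simp [k]
      have h1 := Lp.coeFn_finsetSum Finset.univ (fun i : I => L (Pi.single i 1) • U (i : H))
      have h2 : ∀ᵐ ω ∂P₀, ∀ i : I, (L (Pi.single i 1) • U (i : H) : Lp ℝ 2 P₀) ω
          = L (Pi.single i 1) * U (i : H) ω := by
        refine eventually_all.2 fun i => ?_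
        filter_upwards [Lp.coeFn_smul (L (Pi.single i 1)) (U (i : H))] with ω h3
        rw [h3, Pi.smul_apply, smul_eq_mul]
      filter_upwards [h1, h2] with ω h3 h4
      rw [h0, h3, Finset.sum_apply, Finset.sum_congr rfl fun i _ => h4 i]
      have h5 := L.toLinearMap.pi_apply_eq_sum_univ (I.restrict (T ω))
      refine h5.trans (Finset.sum_congr rfl fun i _ => ?_)
      have h6 : (fun j => if i = j then (1 : ℝ) else 0) = Pi.single i 1 := by
        ext j; simp [Pi.single_apply, eq_comm]
      rw [h6, smul_eq_mul, mul_comm]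
      rfl
    have hφ : Measurable ((fun w : H → ℝ => I.restrict w) ∘ T) := hr.comp hT
    have hlawL : (P₀.map ((fun w => I.restrict w) ∘ T)).map L
        = gaussianReal 0 (‖k‖ ^ 2).toNNReal := by
      rw [Measure.map_map L.continuous.measurable hφ, ← hU k]
      exact Measure.map_congr hk
    have hint : ∫ x, L x ∂(P₀.map ((fun w => I.restrict w) ∘ T)) = 0 := by
      have := integral_map (μ := P₀.map ((fun w => I.restrict w) ∘ T)) (φ := L)
        (f := fun x : ℝ => x) (by fun_prop) (by fun_prop)
      rw [← this, hlawL]; simp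
    have hvar : Var[L; P₀.map ((fun w => I.restrict w) ∘ T)] = ‖k‖ ^ 2 := by
      have := variance_map (μ := P₀.map ((fun w => I.restrict w) ∘ T)) (X := fun x : ℝ => x)
        (Y := L) (by fun_prop) (by fun_prop)
      rw [hlawL] at this
      simpa [Function.comp_def] using this.symm
    rw [hlawL, hint, hvar]
  · rw [integral_map hT.aemeasurable (measurable_pi_apply h).aestronglyMeasurable]
    exact hU0 h
  · rw [covariance_map (measurable_pi_apply g).aestronglyMeasurable
      (measurable_pi_apply h).aestronglyMeasurable hT.aemeasurable]
    change cov[(U g : (s → ℝ) → ℝ), (U h : (s → ℝ) → ℝ); P₀] = _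
    rw [covariance_eq_sub (Lp.memLp _) (Lp.memLp _), hU0, hU0, ← U.inner_map_map, L2.inner_def,
      mul_zero, sub_zero]
    refine integral_congr_ae (Eventually.of_forall fun ω => ?_)
    exact mul_comm _ _

/-- The law of standard Gaussian white noise on `S^d`: the (unique) law of a centred Gaussian
process `g ↦ ∫ g dW` indexed by `L²(S^d)` with covariance `⟨g, h⟩_{L²}`. -/
noncomputable def whiteNoise (d : ℕ) : Measure (Lp ℝ 2 (sphereMeasure d) → ℝ) :=
  (exists_isIsonormalLaw (Lp ℝ 2 (sphereMeasure d))).choose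

theorem isIsonormalLaw_whiteNoise (d : ℕ) : IsIsonormalLaw (whiteNoise d) :=
  (exists_isIsonormalLaw (Lp ℝ 2 (sphereMeasure d))).choose_spec

instance isProbabilityMeasure_whiteNoise (d : ℕ) : IsProbabilityMeasure (whiteNoise d) :=
  (isIsonormalLaw_whiteNoise d).gaussian.isProbabilityMeasure

/-! ### The experiments -/

/-- The regression experiment with observations `Z_i = f (x_i) + σ ε_i`, `i = 1, …, n`, where
`ε_1, …, ε_n` are i.i.d. standard Gaussian and `f` ranges over `Θ`. -/
noncomputable def regressionExperiment {d n : ℕ} (Θ : Set (UnitSphere d → ℝ))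
    (x : Fin n → UnitSphere d) (σ : ℝ) : StatExperiment Θ where
  Sample := Fin n → ℝ
  law f := (Measure.pi fun _ : Fin n => gaussianReal 0 1).map
    fun ε i => (f : UnitSphere d → ℝ) (x i) + σ * ε i
  isProbabilityMeasure _ := Measure.isProbabilityMeasure_map (measurable_pi_lambda _ fun i =>
    ((measurable_pi_apply i).const_mul σ).const_add _).aemeasurable

/-- The white noise experiment `dZ = b_f dμ + τ dW` with drift `b_f`, `f ∈ Θ`, and noise level `τ`:
the observation is the process `g ↦ ∫ b_f g dμ + τ ∫ g dW` indexed by `g ∈ L²(S^d)`. -/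
noncomputable def whiteNoiseExperiment {d : ℕ} (Θ : Set (UnitSphere d → ℝ))
    (b : (UnitSphere d → ℝ) → UnitSphere d → ℝ) (τ : ℝ) : StatExperiment Θ where
  Sample := Lp ℝ 2 (sphereMeasure d) → ℝ
  law f := (whiteNoise d).map fun w g => (∫ y, b f y * g y ∂sphereMeasure d) + τ * w g
  isProbabilityMeasure _ := Measure.isProbabilityMeasure_map
    (measurable_pi_lambda _ fun g => ((measurable_pi_apply g).const_mul τ).const_add _).aemeasurable

/-! ### The bound -/

/-- The standard Gaussian distribution function `Φ` on the extended real line, with `Φ(-∞) = 0` and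
`Φ(∞) = 1`. -/
noncomputable def stdGaussianCDF (z : EReal) : ℝ≥0∞ := gaussianReal 0 1 {y : ℝ | (y : EReal) ≤ z}

/-- The quantity `1 - 2 Φ(-a)` for `a ∈ [0, ∞]`. As `Φ(-a) ≤ 1/2`, the subtraction in `[0, ∞]` is
the usual one. -/
noncomputable def oneSubTwoCDF (a : ℝ≥0∞) : ℝ≥0∞ := 1 - 2 * stdGaussianCDF (-(a : EReal))

/-! ### Total variation distance and deficiency -/

section TotalVariation

variable {X Y : Type*} [MeasurableSpace X] [MeasurableSpace Y]

/-! The three-term bound is the triangle inequality for the Le Cam distance. The rest depends on one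
fact: since $t \ge 2L$, the square of a function in $\mathscr P_L^d$ is integrated exactly by the
design. Hence the coefficient map $c \mapsto \sum_j c_j\psi_j$ into $L^2(\mu)$ and the map $c
\mapsto n^{-1/2}(\sum_j c_j\psi_j(x_i))_i$ into $\mathbb R^n$ induce the same seminorm, and their
ranges are isometric.

For $\Delta_1$, this isometry carries signal and noise across in either direction. On the orthogonal
complement of the range there is no signal, so the missing noise is supplied by independent Gaussian
randomness. Thus the white noise experiment with drift $\tilde f_m$ and the Gaussian vector with
means $\tilde f_m(x_i)$ and variance $\sigma^2$ simulate each other exactly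
(`exists_kernel_gaussianShift_to_isonormal`, `exists_kernel_isonormal_to_gaussianShift`). Only the
cost of replacing $f(x_i)$ by $\tilde f_m(x_i)$ remains, and Markov kernels do not increase it.

For $\Delta_2$, the identity kernel bounds the distance by total variation. Two Gaussian fields with
equal covariance differ along one direction $u$ only, so by sufficiency their distance is that of
$N(\pm\|u\|/2, 1)$, which is $1-2\Phi(-\|u\|/2)$ (`tvDist_le_of_isGaussianField`,
`le_tvDist_of_isGaussianField`, `tvDist_gaussianReal_neg`). Read as the standard Gaussian mass of an
open symmetric interval, this expression commutes with suprema and is at most its length. -/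

theorem tvDist_le_iff {P Q : Measure X} [IsProbabilityMeasure P] [IsProbabilityMeasure Q]
    {D : ℝ≥0∞} : tvDist P Q ≤ D ↔ ∀ A, MeasurableSet A → P A ≤ Q A + D := by
  rcases eq_or_ne D ∞ with rfl | hD
  · simp
  simp only [tvDist, iSup_le_iff, ENNReal.ofReal_le_iff_le_toReal hD, abs_le]
  have key : ∀ A, P A ≤ Q A + D ↔ P.real A ≤ Q.real A + D.toReal := fun A => by
    rw [measureReal_def, measureReal_def, ← ENNReal.toReal_add (measure_ne_top _ _) hD,
      ENNReal.toReal_le_toReal (measure_ne_top _ _) (by finiteness)]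
  simp only [key]
  refine ⟨fun h A hA => by linarith [(h A hA).2], fun h A hA => ⟨?_, by linarith [h A hA]⟩⟩
  -- The one-sided bound at the complement is the other side of the absolute value.
  have := h Aᶜ hA.compl
  rw [probReal_compl_eq_one_sub hA, probReal_compl_eq_one_sub hA] at this
  linarith

theorem measure_le_add_tvDist (P Q : Measure X) [IsProbabilityMeasure P] [IsProbabilityMeasure Q]
    {A : Set X} (hA : MeasurableSet A) : P A ≤ Q A + tvDist P Q :=
  tvDist_le_iff.1 le_rfl A hA

theorem tvDist_comm (P Q : Measure X) : tvDist P Q = tvDist Q P := by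
  simp only [tvDist, abs_sub_comm]

theorem tvDist_self (P : Measure X) : tvDist P P = 0 := by
  simp [tvDist]

theorem tvDist_triangle (P Q R : Measure X) [IsProbabilityMeasure P] [IsProbabilityMeasure Q]
    [IsProbabilityMeasure R] : tvDist P R ≤ tvDist P Q + tvDist Q R := by
  refine tvDist_le_iff.2 fun A hA => (measure_le_add_tvDist P Q hA).trans ?_
  rw [add_comm (tvDist P Q), ← add_assoc]
  gcongr
  exact measure_le_add_tvDist Q R hA

/-- Layer cake: the integral of a $[0,1]$-valued function averages the measures of its superlevel
sets over levels in $(0,1]$, and each of them changes by at most the total variation distance. -/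
theorem lintegral_le_add_tvDist (P Q : Measure X) [IsProbabilityMeasure P]
    [IsProbabilityMeasure Q] {g : X → ℝ} (hg : Measurable g) (h0 : ∀ x, 0 ≤ g x)
    (h1 : ∀ x, g x ≤ 1) :
    ∫⁻ x, ENNReal.ofReal (g x) ∂P ≤ ∫⁻ x, ENNReal.ofReal (g x) ∂Q + tvDist P Q := by
  have key : ∀ ρ : Measure X, ∫⁻ x, ENNReal.ofReal (g x) ∂ρ
      = ∫⁻ t in Set.Ioc (0 : ℝ) 1, ρ {a | t ≤ g a} := fun ρ => by
    rw [lintegral_eq_lintegral_meas_le ρ (Eventually.of_forall h0) hg.aemeasurable]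
    rw [← Set.Ioc_union_Ioi_eq_Ioi (zero_le_one' ℝ), lintegral_union measurableSet_Ioi
      (Set.Ioc_disjoint_Ioi le_rfl), setLIntegral_eq_zero measurableSet_Ioi, add_zero]
    intro t ht
    have : {a | t ≤ g a} = ∅ :=
      Set.eq_empty_of_forall_notMem fun a ha => (h1 a).not_gt (lt_of_lt_of_le ht ha)
    simp [this]
  rw [key, key]
  calc ∫⁻ t in Set.Ioc (0 : ℝ) 1, P {a | t ≤ g a}
      ≤ ∫⁻ t in Set.Ioc (0 : ℝ) 1, (Q {a | t ≤ g a} + tvDist P Q) :=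
        lintegral_mono fun t => measure_le_add_tvDist P Q (measurableSet_le measurable_const hg)
    _ = _ := by
        rw [lintegral_add_right _ measurable_const]
        simp

/-- Data processing: $(KP)(A)$ is the $P$-integral of the $[0,1]$-valued function $x \mapsto K(x,
A)$. -/
theorem tvDist_comp_le (K : Kernel X Y) [IsMarkovKernel K] (P Q : Measure X)
    [IsProbabilityMeasure P] [IsProbabilityMeasure Q] : tvDist (K ∘ₘ P) (K ∘ₘ Q) ≤ tvDist P Q := by
  refine tvDist_le_iff.2 fun A hA => ?_
  rw [Measure.bind_apply hA K.aemeasurable, Measure.bind_apply hA K.aemeasurable]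
  have := lintegral_le_add_tvDist P Q (g := fun x => (K x).real A)
    (K.measurable_coe hA).ennreal_toReal (fun _ => measureReal_nonneg) (fun _ => measureReal_le_one)
  simpa using this

theorem tvDist_map_le {f : X → Y} (hf : Measurable f) (P Q : Measure X)
    [IsProbabilityMeasure P] [IsProbabilityMeasure Q] : tvDist (P.map f) (Q.map f) ≤ tvDist P Q := by
  have := tvDist_comp_le (Kernel.deterministic f hf) P Q
  rwa [Measure.deterministic_comp_eq_map, Measure.deterministic_comp_eq_map] at this

/-- All explicit randomizations have this form: draw auxiliary noise from `R`, independent of the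
observation, and apply `T`. The kernel is fixed before `P`, as the deficiency demands. -/
theorem exists_markovKernel_comp_eq_map_prod {Z : Type*} [MeasurableSpace Z] (R : Measure Y)
    [IsProbabilityMeasure R] {T : X × Y → Z} (hT : Measurable T) :
    ∃ K : Kernel X Z, IsMarkovKernel K ∧
      ∀ (P : Measure X) [IsProbabilityMeasure P], K ∘ₘ P = (P.prod R).map T := by
  refine ⟨(Kernel.id ×ₖ Kernel.const X R).map T, Kernel.IsMarkovKernel.map _ hT, fun P _ => ?_⟩
  rw [← Measure.map_comp _ _ hT, ← Measure.compProd_eq_comp_prod, Measure.compProd_const]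

theorem deficiency_le_iSup {Θ : Type*} {X Y : Type} [MeasurableSpace X] [MeasurableSpace Y]
    (P : Θ → Measure X) (Q : Θ → Measure Y) [∀ θ, IsProbabilityMeasure (P θ)]
    [∀ θ, IsProbabilityMeasure (Q θ)] (K : Kernel X Y) [IsMarkovKernel K] :
    deficiency (StatExperiment.mk X P) (StatExperiment.mk Y Q)
      ≤ ⨆ θ, tvDist (K ∘ₘ P θ) (Q θ) :=
  iInf₂_le K ‹_›

theorem leCamDist_le_iSup_tvDist {Θ : Type*} {X : Type} [MeasurableSpace X]
    (P Q : Θ → Measure X) [∀ θ, IsProbabilityMeasure (P θ)] [∀ θ, IsProbabilityMeasure (Q θ)] :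
    leCamDist (StatExperiment.mk X P) (StatExperiment.mk X Q) ≤ ⨆ θ, tvDist (P θ) (Q θ) := by
  refine max_le ?_ ?_
  · simpa using deficiency_le_iSup P Q Kernel.id
  · simpa [tvDist_comm] using deficiency_le_iSup Q P Kernel.id

theorem deficiency_triangle {Θ : Type*} (E F G : StatExperiment Θ) :
    deficiency E G ≤ deficiency E F + deficiency F G := by
  rw [deficiency, deficiency.eq_def E F, deficiency.eq_def F G]
  simp only [ENNReal.iInf_add, ENNReal.add_iInf]
  refine le_iInf fun K' => le_iInf fun hK' => le_iInf fun K => le_iInf fun hK => ?_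
  -- The composite of the two randomizations is a competitor in the infimum.
  refine (deficiency_le_iSup E.law G.law (K' ∘ₖ K)).trans (iSup_le fun θ => ?_)
  rw [← Measure.comp_assoc]
  refine (tvDist_triangle _ (K' ∘ₘ F.law θ) _).trans (add_le_add ?_ ?_)
  · exact (tvDist_comp_le K' _ _).trans
      (le_iSup (fun θ => tvDist (K ∘ₘ E.law θ) (F.law θ)) θ)
  · exact le_iSup (fun θ => tvDist (K' ∘ₘ F.law θ) (G.law θ)) θ

theorem leCamDist_triangle {Θ : Type*} (E F G : StatExperiment Θ) :
    leCamDist E G ≤ leCamDist E F + leCamDist F G := by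
  refine max_le ((deficiency_triangle E F G).trans ?_) ((deficiency_triangle G F E).trans ?_)
  · exact add_le_add (le_max_left _ _) (le_max_left _ _)
  · rw [add_comm]
    exact add_le_add (le_max_right _ _) (le_max_right _ _)

end TotalVariation

/-! ### Gaussian fields -/

section GaussianField

open Finsupp (linearCombination)

variable {Ω Ω' S T H H' H'' : Type*} [MeasurableSpace Ω] [MeasurableSpace Ω']
  [NormedAddCommGroup H] [InnerProductSpace ℝ H]
  [NormedAddCommGroup H'] [InnerProductSpace ℝ H']
  [NormedAddCommGroup H''] [InnerProductSpace ℝ H'']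

/-- Under `P` the random variables `X t` are jointly Gaussian with means `m t` and covariances
`⟪φ s, φ t⟫`. -/
structure IsGaussianField (P : Measure Ω) (X : T → Ω → ℝ) (m : T → ℝ) (φ : T → H) : Prop where
  measurable : ∀ t, Measurable (X t)
  map_linearCombination : ∀ c : T →₀ ℝ, P.map (linearCombination ℝ X c)
    = gaussianReal (linearCombination ℝ m c) (‖linearCombination ℝ φ c‖₊ ^ 2)

theorem linearCombination_pi_apply {Ω T : Type*} (X : T → Ω → ℝ) (c : T →₀ ℝ) (ω : Ω) :
    linearCombination ℝ X c ω = linearCombination ℝ (fun t => X t ω) c :=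
  Finsupp.apply_linearCombination ℝ (LinearMap.proj (R := ℝ) (φ := fun _ : Ω => ℝ) ω) X c

theorem measurable_linearCombination_pi {X : T → Ω → ℝ} (hX : ∀ t, Measurable (X t))
    (c : T →₀ ℝ) : Measurable (linearCombination ℝ X c) := by
  rw [Finsupp.linearCombination_apply, Finsupp.sum, Finset.sum_fn]
  exact Finset.measurable_sum _ fun t _ => (hX t).const_smul (c t)

namespace IsGaussianField

variable {P : Measure Ω} {Q : Measure Ω'} {X : T → Ω → ℝ} {Y : T → Ω' → ℝ} {m m' : T → ℝ}
  {φ : T → H} {ψ : T → H'} {χ : T → H''}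

theorem measurable_linearCombination (hX : IsGaussianField P X m φ) (c : T →₀ ℝ) :
    Measurable (linearCombination ℝ X c) :=
  measurable_linearCombination_pi hX.measurable c

theorem measurable_pi (hX : IsGaussianField P X m φ) : Measurable fun ω t => X t ω :=
  measurable_pi_lambda _ hX.measurable

/-- Cramér–Wold: the laws of all finite linear combinations determine the finite-dimensional
marginals, and these determine the law on the product σ-algebra. -/
theorem map_eq [IsProbabilityMeasure P] [IsProbabilityMeasure Q] (hX : IsGaussianField P X m φ)
    (hY : IsGaussianField Q Y m φ) : P.map (fun ω t => X t ω) = Q.map fun ω t => Y t ω := by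
  classical
  have := Measure.isProbabilityMeasure_map (μ := P) hX.measurable_pi.aemeasurable
  have := Measure.isProbabilityMeasure_map (μ := Q) hY.measurable_pi.aemeasurable
  refine IsProjectiveLimit.unique (P := fun I => (P.map fun ω t => X t ω).map I.restrict)
    (fun I => rfl) fun I => ?_
  refine Measure.ext_of_charFunDual (funext fun L => ?_)
  -- The coefficients of the functional `L` in the coordinates of `I`.
  let c : T →₀ ℝ := ∑ i : I, Finsupp.single (i : T) (L (Pi.single i 1))
  have key : ∀ w : T → ℝ, L (I.restrict w) = linearCombination ℝ w c := fun w => by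
    have h1 := L.toLinearMap.pi_apply_eq_sum_univ (I.restrict w)
    have h2 : ∀ i : I, (fun j => if i = j then (1 : ℝ) else 0) = Pi.single i 1 := fun i => by
      ext j; simp [Pi.single_apply, eq_comm]
    simp only [h2] at h1
    refine h1.trans ?_
    simp [c, map_sum, Finsupp.linearCombination_single, mul_comm]
  have hr : Measurable (I.restrict : (T → ℝ) → I → ℝ) := by fun_prop
  have hL : Measurable L := L.continuous.measurable
  have h3 : (L ∘ I.restrict) ∘ (fun ω t => X t ω) = linearCombination ℝ X c := by
    ext ω; rw [linearCombination_pi_apply, ← key]; rfl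
  have h4 : (L ∘ I.restrict) ∘ (fun ω t => Y t ω) = linearCombination ℝ Y c := by
    ext ω; rw [linearCombination_pi_apply, ← key]; rfl
  rw [charFunDual_eq_charFun_map_one, charFunDual_eq_charFun_map_one, Measure.map_map hL hr,
    Measure.map_map hL hr, Measure.map_map (hL.comp hr) hX.measurable_pi,
    Measure.map_map (hL.comp hr) hY.measurable_pi, h3, h4, hX.map_linearCombination,
    hY.map_linearCombination]

theorem const_add_mul (hX : IsGaussianField P X m φ) (r : T → ℝ) (a : ℝ) :
    IsGaussianField P (fun t ω => r t + a * X t ω) (fun t => r t + a * m t) (fun t => a • φ t) := by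
  refine ⟨fun t => ((hX.measurable t).const_mul a).const_add _, fun c => ?_⟩
  have hlin : ∀ w : T → ℝ, linearCombination ℝ (fun t => r t + a * w t) c
      = linearCombination ℝ r c + a * linearCombination ℝ w c := fun w => by
    simp only [Finsupp.linearCombination_apply, Finsupp.sum, smul_eq_mul, mul_add,
      Finset.sum_add_distrib, Finset.mul_sum]
    congr 1
    exact Finset.sum_congr rfl fun _ _ => by ring
  have h1 : linearCombination ℝ (fun t ω => r t + a * X t ω) c
      = (fun y => linearCombination ℝ r c + y) ∘ (fun y => a * y) ∘ linearCombination ℝ X c := by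
    ext ω; simp only [linearCombination_pi_apply, hlin, Function.comp]
  have h2 : linearCombination ℝ (fun t => a • φ t) c = a • linearCombination ℝ φ c := by
    simp only [Finsupp.linearCombination_apply, Finsupp.sum, Finset.smul_sum, smul_comm a]
  rw [h1, ← Measure.map_map (measurable_const_add _)
      ((measurable_const_mul a).comp (hX.measurable_linearCombination c)),
    ← Measure.map_map (measurable_const_mul a) (hX.measurable_linearCombination c),
    hX.map_linearCombination, gaussianReal_map_const_mul, gaussianReal_map_const_add, hlin, h2]
  congr 1
  · ring
  · ext; simp [norm_smul, mul_pow]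

theorem comp (hX : IsGaussianField P X m φ) (g : S → T) :
    IsGaussianField P (fun s => X (g s)) (fun s => m (g s)) (fun s => φ (g s)) := by
  refine ⟨fun s => hX.measurable _, fun c => ?_⟩
  have := hX.map_linearCombination (c.mapDomain g)
  simpa only [Finsupp.linearCombination_mapDomain, Function.comp_def] using this

/-- Variances of independent Gaussians add, so the hypothesis is Pythagoras for the covariance
structures: splitting a vector orthogonally into two parts splits its noise into independent
summands. -/
theorem add_prod [IsProbabilityMeasure P] [IsProbabilityMeasure Q] (hX : IsGaussianField P X m φ)
    (hY : IsGaussianField Q Y m' ψ)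
    (h : ∀ c, ‖linearCombination ℝ χ c‖ ^ 2
      = ‖linearCombination ℝ φ c‖ ^ 2 + ‖linearCombination ℝ ψ c‖ ^ 2) :
    IsGaussianField (P.prod Q) (fun t ω => X t ω.1 + Y t ω.2) (fun t => m t + m' t) χ := by
  refine ⟨fun t => ((hX.measurable t).comp measurable_fst).add
    ((hY.measurable t).comp measurable_snd), fun c => ?_⟩
  have hlin : ∀ w w' : T → ℝ, linearCombination ℝ (fun t => w t + w' t) c
      = linearCombination ℝ w c + linearCombination ℝ w' c := fun w w' => by
    simp only [Finsupp.linearCombination_apply, Finsupp.sum, smul_eq_mul, mul_add,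
      Finset.sum_add_distrib]
  have h1 : linearCombination ℝ (fun t (ω : Ω × Ω') => X t ω.1 + Y t ω.2) c
      = (fun ω : Ω × Ω' => linearCombination ℝ X c ω.1)
        + fun ω : Ω × Ω' => linearCombination ℝ Y c ω.2 := by
    ext ω; simp only [linearCombination_pi_apply, hlin, Pi.add_apply]
  have hXm := hX.measurable_linearCombination c
  have hYm := hY.measurable_linearCombination c
  have h2 : (P.prod Q).map (fun ω : Ω × Ω' => linearCombination ℝ X c ω.1)
      = gaussianReal (linearCombination ℝ m c) (‖linearCombination ℝ φ c‖₊ ^ 2) := by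
    rw [← hX.map_linearCombination]
    have := Measure.map_map (μ := P.prod Q) hXm measurable_fst
    rw [Measure.map_fst_prod] at this
    simpa [Function.comp_def] using this.symm
  have h3 : (P.prod Q).map (fun ω : Ω × Ω' => linearCombination ℝ Y c ω.2)
      = gaussianReal (linearCombination ℝ m' c) (‖linearCombination ℝ ψ c‖₊ ^ 2) := by
    rw [← hY.map_linearCombination]
    have := Measure.map_map (μ := P.prod Q) hYm measurable_snd
    rw [Measure.map_snd_prod] at this
    simpa [Function.comp_def] using this.symm
  rw [h1, gaussianReal_add_gaussianReal_of_indepFun (indepFun_prod hXm hYm) h2 h3, hlin]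
  congr 1
  ext
  simpa using (h c).symm

theorem of_map {f : Ω' → Ω} (hf : Measurable f) (hX : ∀ t, Measurable (X t))
    (h : IsGaussianField Q (fun t ω => X t (f ω)) m φ) : IsGaussianField (Q.map f) X m φ := by
  refine ⟨hX, fun c => ?_⟩
  rw [← h.map_linearCombination, Measure.map_map _ hf]
  · congr 1
    ext ω
    simp only [Function.comp, linearCombination_pi_apply]
  · exact measurable_linearCombination_pi hX c

end IsGaussianField

theorem IsIsonormalLaw.isGaussianField {P : Measure (H → ℝ)} (hP : IsIsonormalLaw P) :
    IsGaussianField P (fun h w => w h) 0 (id : H → H) := by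
  have := hP.gaussian.isProbabilityMeasure
  refine ⟨fun h => measurable_pi_apply h, fun c => ?_⟩
  have hmem : ∀ h : H, MemLp (fun w : H → ℝ => w h) 2 P := fun h =>
    (hP.gaussian.hasGaussianLaw_eval h).memLp_two
  have hmem' : ∀ h : H, MemLp (fun w : H → ℝ => c h • w h) 2 P := fun h => (hmem h).const_mul _
  have hX : linearCombination ℝ (fun (h : H) (w : H → ℝ) => w h) c
      = fun w => ∑ h ∈ c.support, c h • w h := by
    ext w
    rw [linearCombination_pi_apply, Finsupp.linearCombination_apply, Finsupp.sum]
  have hg : HasGaussianLaw (fun w : H → ℝ => ∑ h ∈ c.support, c h • w h) P :=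
    (hP.gaussian.smul (fun h => c h)).hasGaussianLaw_fun_sum
  have hint : ∫ w, ∑ h ∈ c.support, c h • w h ∂P = 0 := by
    rw [integral_finsetSum _ fun h _ => (hmem' h).integrable one_le_two]
    simp [integral_const_mul, hP.mean]
  have hvar : Var[fun w : H → ℝ => ∑ h ∈ c.support, c h • w h; P]
      = ‖linearCombination ℝ (id : H → H) c‖ ^ 2 := by
    rw [← covariance_self hg.aemeasurable, covariance_fun_sum_fun_sum' (fun h _ => hmem' h)
      (fun h _ => hmem' h), ← real_inner_self_eq_norm_sq, Finsupp.linearCombination_apply,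
      Finsupp.sum, sum_inner]
    refine Finset.sum_congr rfl fun g _ => ?_
    rw [inner_sum]
    refine Finset.sum_congr rfl fun h _ => ?_
    simp only [smul_eq_mul]
    rw [covariance_const_mul_left, covariance_const_mul_right, hP.cov, inner_smul_left,
      inner_smul_right]
    simp
  rw [hX, hg.map_eq_gaussianReal, hint, hvar]
  congr 1
  · simp
  · ext; simp

theorem map_pi_gaussianReal_sum {n : ℕ} (v : EuclideanSpace ℝ (Fin n)) :
    (Measure.pi fun _ : Fin n => gaussianReal 0 1).map (fun ε => ∑ i, v i * ε i)
      = gaussianReal 0 (‖v‖₊ ^ 2) := by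
  have h1 : (fun ε : Fin n → ℝ => ∑ i, v i * ε i) = innerSL ℝ v ∘ WithLp.toLp 2 := by
    ext ε; simp [PiLp.inner_apply, mul_comm]
  rw [h1, ← Measure.map_map (by fun_prop) (by fun_prop), map_pi_eq_stdGaussian,
    IsGaussian.map_eq_gaussianReal, integral_strongDual_stdGaussian, variance_dual_stdGaussian]
  congr 1
  ext; simp

theorem isGaussianField_pi_gaussianReal (n : ℕ) :
    IsGaussianField (Measure.pi fun _ : Fin n => gaussianReal 0 1)
      (fun (v : EuclideanSpace ℝ (Fin n)) ε => ∑ i, v i * ε i) 0 id := by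
  refine ⟨fun v => by fun_prop, fun c => ?_⟩
  have h : linearCombination ℝ (fun (v : EuclideanSpace ℝ (Fin n)) (ε : Fin n → ℝ) =>
      ∑ i, v i * ε i) c = fun ε => ∑ i, (linearCombination ℝ id c : EuclideanSpace ℝ (Fin n)) i * ε i := by
    ext ε
    let A : EuclideanSpace ℝ (Fin n) →ₗ[ℝ] ℝ :=
      { toFun := fun v => ∑ i, v i * ε i
        map_add' := fun v w => by simp [add_mul, Finset.sum_add_distrib]
        map_smul' := fun a v => by simp [mul_assoc, Finset.mul_sum] }
    rw [linearCombination_pi_apply]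
    exact (Finsupp.apply_linearCombination ℝ A id c).symm
  rw [h, map_pi_gaussianReal_sum]
  simp

theorem isGaussianField_gaussianReal (h : ℝ) (a : T → ℝ) :
    IsGaussianField (gaussianReal h 1) (fun t y => a t * y) (fun t => a t * h) a := by
  refine ⟨fun t => by fun_prop, fun c => ?_⟩
  have hlin : ∀ y, linearCombination ℝ (fun t => a t * y) c = linearCombination ℝ a c * y :=
    fun y => by
      simp only [Finsupp.linearCombination_apply, Finsupp.sum, smul_eq_mul, Finset.sum_mul,
        mul_assoc]
  have h1 : linearCombination ℝ (fun t y => a t * y) c = fun y => linearCombination ℝ a c * y := by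
    ext y; rw [linearCombination_pi_apply, hlin]
  rw [h1, gaussianReal_map_const_mul, hlin]
  congr 1
  ext; simp

/-- The bound is by sufficiency: a sample of the field is obtained from one real Gaussian variable,
which carries the difference of the means, by adding independent Gaussian noise. -/
theorem tvDist_le_of_isGaussianField [CompleteSpace H] {P Q : Measure (T → ℝ)}
    [IsProbabilityMeasure P] [IsProbabilityMeasure Q] {m m' : T → ℝ} {φ : T → H}
    (hP : IsGaussianField P (fun t w => w t) m φ) (hQ : IsGaussianField Q (fun t w => w t) m' φ)
    {u : H} (hu : ∀ t, m t - m' t = ⟪u, φ t⟫) :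
    tvDist P Q ≤ tvDist (gaussianReal (‖u‖ / 2) 1) (gaussianReal (-(‖u‖ / 2)) 1) := by
  obtain ⟨W, hW⟩ := exists_isIsonormalLaw H
  have := hW.gaussian.isProbabilityMeasure
  -- `e` is the unit vector along `u`, with the convention `e = 0` when `u = 0`.
  obtain ⟨e, he, hee⟩ : ∃ e : H, ‖u‖ • e = u ∧ (⟪e, e⟫ = 1 ∨ e = 0) := by
    rcases eq_or_ne u 0 with rfl | h
    · exact ⟨0, by simp, Or.inr rfl⟩
    · exact ⟨‖u‖⁻¹ • u, by simp [smul_smul, norm_ne_zero_iff.2 h],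
        Or.inl (by simp [norm_smul, norm_ne_zero_iff.2 h])⟩
  let a : T → ℝ := fun t => ⟪e, φ t⟫
  -- The projection onto the complement of `e`: here the two fields have the same noise and no
  -- difference of means.
  let R : H →ₗ[ℝ] H := LinearMap.id - (innerSL ℝ e).toLinearMap.smulRight e
  have hnorm : ∀ c, ‖linearCombination ℝ φ c‖ ^ 2 = ‖linearCombination ℝ a c‖ ^ 2
      + ‖linearCombination ℝ (fun t => R (φ t)) c‖ ^ 2 := fun c => by
    have h1 := Finsupp.apply_linearCombination ℝ (innerSL ℝ e).toLinearMap φ c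
    have h2 := Finsupp.apply_linearCombination ℝ R φ c
    rw [show linearCombination ℝ a c = ⟪e, linearCombination ℝ φ c⟫ from h1.symm,
      show linearCombination ℝ (fun t => R (φ t)) c = R (linearCombination ℝ φ c) from h2.symm]
    generalize linearCombination ℝ φ c = v
    simp only [R, LinearMap.sub_apply, LinearMap.id_apply, LinearMap.smulRight_apply,
      ContinuousLinearMap.coe_coe, innerSL_apply_apply]
    rw [norm_sub_sq_real, inner_smul_right, real_inner_comm, norm_smul, mul_pow,
      ← real_inner_self_eq_norm_sq e, Real.norm_eq_abs, sq_abs]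
    rcases hee with h | h
    · rw [h]; ring
    · simp [h]
  -- One variable $y \sim N(h, 1)$ generates the whole field as midpoint of the means plus $a_t y$
  -- plus independent noise in the directions `R (φ t)`. The choices $h = \pm\|u\|/2$ give `P` and
  -- `Q`.
  have key : ∀ h : ℝ, IsGaussianField ((gaussianReal h 1).prod W)
      (fun t ω => (m t + m' t) / 2 + 1 * (a t * ω.1 + ω.2 (R (φ t))))
      (fun t => (m t + m' t) / 2 + 1 * (a t * h + 0)) φ := fun h => by
    have h1 := (isGaussianField_gaussianReal h a).add_prod
      (hW.isGaussianField.comp fun t => R (φ t)) (χ := φ) hnorm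
    simpa using h1.const_add_mul (fun t => (m t + m' t) / 2) 1
  have hT := (key 0).measurable_pi
  obtain ⟨K, hK, hKP⟩ := exists_markovKernel_comp_eq_map_prod (X := ℝ) W hT
  have hau : ∀ t, a t * ‖u‖ = m t - m' t := fun t => by
    rw [hu, ← he, inner_smul_left, mul_comm, he]; rfl
  have h1 : K ∘ₘ gaussianReal (‖u‖ / 2) 1 = P := by
    rw [hKP]
    have h2 := key (‖u‖ / 2)
    have h3 : (fun t => (m t + m' t) / 2 + 1 * (a t * (‖u‖ / 2) + 0)) = m := by
      ext t; linarith [hau t]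
    rw [h3] at h2
    exact (h2.map_eq hP).trans Measure.map_id
  have h2 : K ∘ₘ gaussianReal (-(‖u‖ / 2)) 1 = Q := by
    rw [hKP]
    have h2 := key (-(‖u‖ / 2))
    have h3 : (fun t => (m t + m' t) / 2 + 1 * (a t * (-(‖u‖ / 2)) + 0)) = m' := by
      ext t; linarith [hau t]
    rw [h3] at h2
    exact (h2.map_eq hQ).trans Measure.map_id
  rw [← h1, ← h2]
  exact tvDist_comp_le K _ _

/-- Observing a single coordinate of unit variance, recentred at the midpoint of its two means,
cannot increase the distance. -/
theorem le_tvDist_of_isGaussianField {P Q : Measure (T → ℝ)}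
    [IsProbabilityMeasure P] [IsProbabilityMeasure Q] {m m' : T → ℝ} {φ : T → H}
    (hP : IsGaussianField P (fun t w => w t) m φ) (hQ : IsGaussianField Q (fun t w => w t) m' φ)
    {t : T} (ht : ‖φ t‖ = 1) :
    tvDist (gaussianReal ((m t - m' t) / 2) 1) (gaussianReal (-((m t - m' t) / 2)) 1)
      ≤ tvDist P Q := by
  have hf : Measurable fun w : T → ℝ => -((m t + m' t) / 2) + 1 * w t := by fun_prop
  have key : ∀ {R : Measure (T → ℝ)} {b : T → ℝ}, IsGaussianField R (fun t w => w t) b φ →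
      R.map (fun w : T → ℝ => -((m t + m' t) / 2) + 1 * w t)
        = gaussianReal (-((m t + m' t) / 2) + 1 * b t) 1 := fun {R b} hR => by
    have := (hR.const_add_mul (fun _ => -((m t + m' t) / 2)) 1).map_linearCombination
      (Finsupp.single t 1)
    have h1 : ‖φ t‖₊ = 1 := NNReal.eq ht
    simpa [h1] using this
  have := tvDist_map_le hf P Q
  rw [key hP, key hQ] at this
  convert! this using 3 <;> ring

end GaussianField

/-! ### Total variation distance of Gaussian shifts -/

section GaussianShift

/-- `B` is a Hahn set for `P - Q`, hence an optimal test. -/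
theorem tvDist_eq_of_le {X : Type*} [MeasurableSpace X] {P Q : Measure X} [IsProbabilityMeasure P]
    [IsProbabilityMeasure Q] {B : Set X} (hB : MeasurableSet B)
    (h1 : ∀ A ⊆ B, MeasurableSet A → Q A ≤ P A) (h2 : ∀ A ⊆ Bᶜ, MeasurableSet A → P A ≤ Q A) :
    tvDist P Q = P B - Q B := by
  refine le_antisymm (tvDist_le_iff.2 fun A hA => ?_)
    (tsub_le_iff_left.2 (measure_le_add_tvDist P Q hB))
  -- Inside `B` the excess of `P` over `Q` grows with the set; adding the mass of `B \ A` to both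
  -- sides avoids subtraction.
  have h3 : P (A ∩ B) ≤ Q (A ∩ B) + (P B - Q B) := by
    have h4 := h1 (B \ A) Set.sdiff_subset (hB.diff hA)
    have h5 := measure_inter_add_sdiff (μ := P) B hA
    have h6 := measure_inter_add_sdiff (μ := Q) B hA
    rw [Set.inter_comm] at h5 h6
    rw [← ENNReal.add_le_add_iff_right (measure_ne_top P (B \ A)), h5]
    calc P B = (P B - Q B) + Q B := (tsub_add_cancel_of_le (h1 B subset_rfl hB)).symm
      _ = Q (A ∩ B) + (P B - Q B) + Q (B \ A) := by rw [← h6]; ring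
      _ ≤ _ := by gcongr
  rw [← measure_inter_add_sdiff (μ := P) A hB, ← measure_inter_add_sdiff (μ := Q) A hB,
    add_right_comm]
  exact add_le_add h3 (h2 _ (fun x hx => hx.2) (hA.diff hB))

theorem gaussianReal_apply_le_of_abs_sub_le {a b : ℝ} {A : Set ℝ} (hA : MeasurableSet A)
    (h : ∀ x ∈ A, |x - b| ≤ |x - a|) : gaussianReal a 1 A ≤ gaussianReal b 1 A := by
  rw [gaussianReal_apply _ one_ne_zero, gaussianReal_apply _ one_ne_zero]
  refine setLIntegral_mono' hA fun x hx => ENNReal.ofReal_le_ofReal ?_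
  have := sq_le_sq.2 (h x hx)
  simp only [gaussianPDFReal]
  gcongr

theorem stdGaussian_Ici (h : ℝ) : gaussianReal 0 1 (Set.Ici h) = gaussianReal 0 1 (Set.Iic (-h)) := by
  have := gaussianReal_map_neg (μ := 0) (v := 1)
  rw [neg_zero] at this
  conv_lhs => rw [← this, Measure.map_apply measurable_neg measurableSet_Ici]
  congr 1
  ext x; simp

theorem gaussianReal_Ioi_zero (h : ℝ) : gaussianReal h 1 (Set.Ioi 0) = gaussianReal 0 1 (Set.Ioi (-h)) := by
  have := gaussianReal_map_const_add (μ := 0) (v := 1) h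
  rw [zero_add] at this
  rw [← this, Measure.map_apply (by fun_prop) measurableSet_Ioi]
  congr 1
  ext x; simp [neg_lt_iff_pos_add']

theorem stdGaussianCDF_neg_ofReal {h : ℝ} (hh : 0 ≤ h) :
    stdGaussianCDF (-(ENNReal.ofReal h : EReal)) = gaussianReal 0 1 (Set.Iic (-h)) := by
  rw [stdGaussianCDF, EReal.coe_ennreal_ofReal, max_eq_left hh]
  congr 1
  ext y
  simp only [Set.mem_ofPred_eq, Set.mem_Iic]
  rw [← EReal.coe_neg, EReal.coe_le_coe_iff]

/-- By symmetry, removing both tails from the total mass leaves the mass of $(-a, a)$, which is all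
of $\mathbb R$ for $a = \infty$. The strict inequality is what later lets increasing intervals
exhaust the one at their supremum. -/
theorem oneSubTwoCDF_eq_measure (a : ℝ≥0∞) :
    oneSubTwoCDF a = gaussianReal 0 1 {y | ENNReal.ofReal |y| < a} := by
  induction a with
  | top => simp [oneSubTwoCDF, stdGaussianCDF]
  | coe a =>
    have ha : (a : ℝ≥0∞) = ENNReal.ofReal a := by simp
    have ha0 : (0 : ℝ) ≤ a := a.2
    have h1 : {y : ℝ | ENNReal.ofReal |y| < a} = Set.Ioo (-(a : ℝ)) a := by
      ext y
      rw [Set.mem_ofPred_eq, ha, ENNReal.ofReal_lt_ofReal_iff_of_nonneg (abs_nonneg y), abs_lt]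
      simp
    have h2 : Set.Ioc (-(a : ℝ)) a = Set.Ioi (-(a : ℝ)) \ Set.Ioi (a : ℝ) := by
      ext y; simp
    have h3 : Set.Ioi (a : ℝ) ⊆ Set.Ioi (-(a : ℝ)) := Set.Ioi_subset_Ioi (by linarith)
    have := nullSingletonClass_gaussianReal (μ := 0) one_ne_zero
    rw [h1, measure_congr Ioo_ae_eq_Ioc, h2, measure_sdiff h3 measurableSet_Ioi.nullMeasurableSet
      (measure_ne_top _ _), measure_congr Ioi_ae_eq_Ici (s := Set.Ioi (a : ℝ)), stdGaussian_Ici,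
      ← Set.compl_Iic, prob_compl_eq_one_sub measurableSet_Iic, oneSubTwoCDF, ha,
      stdGaussianCDF_neg_ofReal ha0, two_mul, ← tsub_tsub]

/-- The densities of $N(h,1)$ and $N(-h,1)$ cross at $0$, so the half-line $(0,\infty)$ is the
optimal test. -/
theorem tvDist_gaussianReal_neg {h : ℝ} (hh : 0 ≤ h) :
    tvDist (gaussianReal h 1) (gaussianReal (-h) 1) = oneSubTwoCDF (ENNReal.ofReal h) := by
  rw [tvDist_eq_of_le (B := Set.Ioi 0) measurableSet_Ioi, gaussianReal_Ioi_zero,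
    gaussianReal_Ioi_zero, neg_neg, oneSubTwoCDF, stdGaussianCDF_neg_ofReal hh, two_mul, ← tsub_tsub]
  · have := nullSingletonClass_gaussianReal (μ := 0) one_ne_zero
    congr 1
    · rw [← Set.compl_Iic, prob_compl_eq_one_sub measurableSet_Iic]
    · rw [← stdGaussian_Ici, measure_congr Ioi_ae_eq_Ici]
  · intro A hAB hA
    refine gaussianReal_apply_le_of_abs_sub_le hA fun x hx => ?_
    have : 0 < x := hAB hx
    exact abs_le.2 ⟨by linarith [le_abs_self (x - -h)], by linarith [le_abs_self (x - -h)]⟩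
  · intro A hAB hA
    refine gaussianReal_apply_le_of_abs_sub_le hA fun x hx => ?_
    have : x ≤ 0 := by simpa using hAB hx
    exact abs_le.2 ⟨by linarith [neg_abs_le (x - h)], by linarith [neg_abs_le (x - h)]⟩

theorem oneSubTwoCDF_mono : Monotone oneSubTwoCDF := fun a b hab => by
  rw [oneSubTwoCDF_eq_measure, oneSubTwoCDF_eq_measure]
  exact measure_mono fun y hy => lt_of_lt_of_le hy hab

theorem oneSubTwoCDF_zero : oneSubTwoCDF 0 = 0 := by
  simp [oneSubTwoCDF_eq_measure]

/-- Continuity from below of the Gaussian measure along a sequence of values of `f` increasing to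
the supremum. An empty family gives the value at $0$. -/
theorem oneSubTwoCDF_iSup {ι : Type*} (f : ι → ℝ≥0∞) :
    oneSubTwoCDF (⨆ i, f i) = ⨆ i, oneSubTwoCDF (f i) := by
  refine le_antisymm ?_ oneSubTwoCDF_mono.le_map_iSup
  cases isEmpty_or_nonempty ι
  · simp [oneSubTwoCDF_zero]
  obtain ⟨u, hu, -, hut, hur⟩ :=
    (isLUB_iSup (f := f)).exists_seq_monotone_tendsto (Set.range_nonempty f)
  have h1 : {y : ℝ | ENNReal.ofReal |y| < ⨆ i, f i} = ⋃ n, {y | ENNReal.ofReal |y| < u n} := by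
    ext y
    simp only [Set.mem_ofPred_eq, Set.mem_iUnion]
    refine ⟨fun hy => (hut.eventually_const_lt hy).exists, fun ⟨n, hn⟩ => hn.trans_le ?_⟩
    obtain ⟨i, hi⟩ := hur n
    exact hi ▸ le_iSup f i
  have h2 : Monotone fun n => {y : ℝ | ENNReal.ofReal |y| < u n} :=
    fun i j hij y hy => lt_of_lt_of_le hy (hu hij)
  rw [oneSubTwoCDF_eq_measure, h1, h2.measure_iUnion]
  refine iSup_le fun n => ?_
  obtain ⟨i, hi⟩ := hur n
  rw [← oneSubTwoCDF_eq_measure, ← hi]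
  exact le_iSup (fun i => oneSubTwoCDF (f i)) i

/-- The Gaussian density is at most $1$ and the interval $(-a,a)$ has length $2a$. -/
theorem oneSubTwoCDF_le (a : ℝ≥0∞) : oneSubTwoCDF a ≤ 2 * a := by
  rcases eq_or_ne a ∞ with rfl | ha
  · simp
  have h1 : {y : ℝ | ENNReal.ofReal |y| < a} ⊆ Metric.ball 0 a.toReal := fun y hy => by
    have := (ENNReal.ofReal_lt_iff_lt_toReal (abs_nonneg y) ha).1 hy
    simpa using this
  have h2 : ∀ y, gaussianPDF 0 1 y ≤ 1 := fun y => by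
    rw [gaussianPDF, ENNReal.ofReal_le_one]
    simp only [gaussianPDFReal, NNReal.coe_one, mul_one]
    refine mul_le_one₀ (inv_le_one_of_one_le₀ (Real.one_le_sqrt.2 ?_)) (Real.exp_nonneg _)
      (Real.exp_le_one_iff.2 ?_)
    · linarith [Real.pi_gt_three]
    · have := sq_nonneg (y - 0)
      linarith
  calc oneSubTwoCDF a ≤ gaussianReal 0 1 (Metric.ball 0 a.toReal) := by
        rw [oneSubTwoCDF_eq_measure]; exact measure_mono h1
    _ ≤ ∫⁻ _ in Metric.ball (0 : ℝ) a.toReal, 1 := by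
        rw [gaussianReal_apply _ one_ne_zero]
        exact lintegral_mono h2
    _ = 2 * a := by
        rw [setLIntegral_one, Real.volume_ball, ENNReal.ofReal_mul zero_le_two,
          ENNReal.ofReal_toReal ha]
        simp

end GaussianShift

/-! ### Randomizations between Gaussian experiments -/

section Randomization

open Finsupp (linearCombination)

/-- The law of a vector with independent Gaussian coordinates of means `b i` and variance `σ ^ 2`. -/
noncomputable def gaussianShift {n : ℕ} (b : Fin n → ℝ) (σ : ℝ) : Measure (Fin n → ℝ) :=
  (Measure.pi fun _ : Fin n => gaussianReal 0 1).map fun ε i => b i + σ * ε i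

theorem measurable_shift {n : ℕ} (b : Fin n → ℝ) (σ : ℝ) :
    Measurable fun (ε : Fin n → ℝ) i => b i + σ * ε i := by
  fun_prop

instance isProbabilityMeasure_gaussianShift {n : ℕ} (b : Fin n → ℝ) (σ : ℝ) :
    IsProbabilityMeasure (gaussianShift b σ) :=
  Measure.isProbabilityMeasure_map (measurable_shift b σ).aemeasurable

theorem isGaussianField_gaussianShift {n : ℕ} (b : Fin n → ℝ) (σ : ℝ) :
    IsGaussianField (gaussianShift b σ) (fun (v : EuclideanSpace ℝ (Fin n)) y => ∑ i, v i * y i)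
      (fun v => ∑ i, v i * b i) (fun v => σ • v) := by
  refine IsGaussianField.of_map (measurable_shift b σ) (fun v => by fun_prop) ?_
  have h := (isGaussianField_pi_gaussianReal n).const_add_mul (fun v => ∑ i, v i * b i) σ
  simp only [Pi.zero_apply, mul_zero, add_zero, id] at h
  convert! h using 3 with v ε
  rw [Finset.mul_sum, ← Finset.sum_add_distrib]
  exact Finset.sum_congr rfl fun i _ => by ring

theorem isGaussianField_gaussianShift_eval {n : ℕ} (b : Fin n → ℝ) (σ : ℝ) :
    IsGaussianField (gaussianShift b σ) (fun i y => y i) b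
      (fun i => σ • (EuclideanSpace.single i 1 : EuclideanSpace ℝ (Fin n))) := by
  have h := (isGaussianField_gaussianShift b σ).comp
    fun i => (EuclideanSpace.single i 1 : EuclideanSpace ℝ (Fin n))
  simpa using h

theorem tvDist_gaussianShift_le {n : ℕ} (b b' : Fin n → ℝ) {σ : ℝ} (hσ : 0 < σ) :
    tvDist (gaussianShift b σ) (gaussianShift b' σ)
      ≤ oneSubTwoCDF (ENNReal.ofReal (1 / (2 * σ) * √(∑ i, (b i - b' i) ^ 2))) := by
  -- Coordinate `i` has covariance vector $\sigma e_i$, so a mean difference `b i - b' i` is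
  -- represented by the vector with entries $(b_i - b'_i)/\sigma$.
  let u : EuclideanSpace ℝ (Fin n) := WithLp.toLp 2 fun i => σ⁻¹ * (b i - b' i)
  have hu : ‖u‖ / 2 = 1 / (2 * σ) * √(∑ i, (b i - b' i) ^ 2) := by
    simp only [u, EuclideanSpace.norm_eq, Real.norm_eq_abs, sq_abs, mul_pow, ← Finset.mul_sum]
    rw [Real.sqrt_mul (by positivity), Real.sqrt_sq (by positivity)]
    field_simp
  rw [← hu, ← tvDist_gaussianReal_neg (by positivity)]
  refine tvDist_le_of_isGaussianField (isGaussianField_gaussianShift_eval b σ)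
    (isGaussianField_gaussianShift_eval b' σ) fun i => ?_
  simp [u, inner_smul_right, EuclideanSpace.inner_single_right, hσ.ne']

variable {M H E : Type*} [AddCommGroup M] [Module ℝ M] [FiniteDimensional ℝ M]
  [NormedAddCommGroup H] [InnerProductSpace ℝ H] [NormedAddCommGroup E] [InnerProductSpace ℝ E]

/-- If two linear maps into inner product spaces induce the same seminorm, the isometry between
their ranges extends to a partial isometry `A`; `R` is the projection onto its kernel. -/
theorem exists_partialIsometry {S : M →ₗ[ℝ] H} {S' : M →ₗ[ℝ] E} (h : ∀ c, ‖S c‖ = ‖S' c‖) :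
    ∃ (A : H →ₗ[ℝ] E) (R : H →ₗ[ℝ] H), (∀ g, ‖g‖ ^ 2 = ‖A g‖ ^ 2 + ‖R g‖ ^ 2) ∧
      ∀ c g, ⟪S' c, A g⟫ = ⟪S c, g⟫ := by
  -- Polarization: equal seminorms force equal inner products.
  have hin : ∀ c c', ⟪S' c, S' c'⟫ = ⟪S c, S c'⟫ := fun c c' => by
    rw [real_inner_eq_norm_add_mul_self_sub_norm_mul_self_sub_norm_mul_self_div_two,
      real_inner_eq_norm_add_mul_self_sub_norm_mul_self_sub_norm_mul_self_div_two (S c)]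
    simp only [← map_add, h]
  -- A linear choice of coefficients for each vector in the range of `S`. `S` need not be injective;
  -- equality of the seminorms makes `S' ∘ r` an isometry on the range.
  obtain ⟨r, hr⟩ := S.rangeRestrict.exists_rightInverse_of_surjective S.range_rangeRestrict
  have hr' : ∀ v : LinearMap.range S, S (r v) = v := fun v =>
    congrArg Subtype.val (LinearMap.congr_fun hr v)
  let V := LinearMap.range S
  let p : H →ₗ[ℝ] V := V.orthogonalProjectionOnto.toLinearMap
  refine ⟨S' ∘ₗ r ∘ₗ p, LinearMap.id - V.subtype ∘ₗ p, fun g => ?_, fun c g => ?_⟩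
  · have h1 := V.norm_sq_eq_add_norm_sq_starProjection g
    rw [Submodule.starProjection_orthogonal_val] at h1
    simp only [LinearMap.comp_apply]
    rw [← h, hr']
    exact h1
  · simp only [LinearMap.comp_apply]
    rw [hin, hr']
    exact V.inner_orthogonalProjectionOnto_eq_of_mem_left ⟨S c, LinearMap.mem_range_self S c⟩ g

variable {n : ℕ} {s τ : ℝ}

theorem linearCombination_linearMap {F : Type*} [AddCommGroup F] [Module ℝ F] (A : H →ₗ[ℝ] F)
    (c : H →₀ ℝ) : linearCombination ℝ (fun g => A g) c = A (linearCombination ℝ id c) :=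
  (Finsupp.apply_linearCombination ℝ A id c).symm

/-- From the vector $y$ form $g \mapsto s^{-1}\langle Ag, y\rangle + \tau W(Rg)$ with independent
white noise $W$. The mean is $\langle S'c, Ag\rangle = \langle Sc, g\rangle$ and the variance is
$\tau^2(\|Ag\|^2 + \|Rg\|^2) = \tau^2\|g\|^2$, with a kernel not depending on `c`. -/
theorem exists_kernel_gaussianShift_to_isonormal [CompleteSpace H] {S : M →ₗ[ℝ] H}
    {S' : M →ₗ[ℝ] EuclideanSpace ℝ (Fin n)} (h : ∀ c, ‖S c‖ = ‖S' c‖) (hs : 0 < s) :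
    ∃ K : Kernel (Fin n → ℝ) (H → ℝ), IsMarkovKernel K ∧
      ∀ (c : M) (Q : Measure (H → ℝ)) [IsProbabilityMeasure Q],
        IsGaussianField Q (fun g w => w g) (fun g => ⟪S c, g⟫) (fun g => τ • g) →
          K ∘ₘ gaussianShift (fun i => s * S' c i) (s * τ) = Q := by
  obtain ⟨A, R, hAR, hA⟩ := exists_partialIsometry h
  obtain ⟨W, hW⟩ := exists_isIsonormalLaw H
  have := hW.gaussian.isProbabilityMeasure
  have hT : Measurable fun (ω : (Fin n → ℝ) × (H → ℝ)) (g : H) =>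
      s⁻¹ * ∑ i, A g i * ω.1 i + τ * ω.2 (R g) :=
    measurable_pi_lambda _ fun g => by fun_prop
  obtain ⟨K, hK, hKP⟩ := exists_markovKernel_comp_eq_map_prod W hT
  refine ⟨K, hK, fun c Q _ hQ => ?_⟩
  rw [hKP]
  have h1 := ((isGaussianField_gaussianShift (fun i => s * S' c i) (s * τ)).comp
    A).const_add_mul 0 s⁻¹
  have h2 := (hW.isGaussianField.comp R).const_add_mul 0 τ
  have h3 := h1.add_prod h2 (χ := fun g => τ • g) fun e => by
    have e1 := linearCombination_linearMap (τ • LinearMap.id : H →ₗ[ℝ] H) e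
    have e2 := linearCombination_linearMap (s⁻¹ • (s * τ) • A) e
    have e3 := linearCombination_linearMap (τ • R) e
    simp only [LinearMap.smul_apply, LinearMap.id_apply] at e1 e2 e3
    simp only [id]
    rw [e1, e2, e3, smul_smul, inv_mul_cancel_left₀ hs.ne', norm_smul, norm_smul, norm_smul,
      mul_pow, mul_pow, mul_pow, hAR, mul_add]
  have h4 : (fun g => (0 : H → ℝ) g + s⁻¹ * (∑ i, A g i * (s * S' c i))
      + ((0 : H → ℝ) g + τ * (0 : H → ℝ) (R g))) = fun g => ⟪S c, g⟫ := by
    ext g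
    rw [← hA, Finset.mul_sum]
    simp only [PiLp.inner_apply, Pi.zero_apply, zero_add, mul_zero, add_zero]
    refine Finset.sum_congr rfl fun i _ => ?_
    simp
    field_simp
  rw [h4] at h3
  simpa using h3.map_eq hQ

/-- The same construction with the spaces exchanged: `A` now maps $\mathbb R^n$ into `H`, and
coordinate `i` is the observed process at `A (e i)`, scaled by `s`, plus independent noise along `R
(e i)`. -/
theorem exists_kernel_isonormal_to_gaussianShift {S : M →ₗ[ℝ] H}
    {S' : M →ₗ[ℝ] EuclideanSpace ℝ (Fin n)} (h : ∀ c, ‖S c‖ = ‖S' c‖) :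
    ∃ K : Kernel (H → ℝ) (Fin n → ℝ), IsMarkovKernel K ∧
      ∀ (c : M) (Q : Measure (H → ℝ)) [IsProbabilityMeasure Q],
        IsGaussianField Q (fun g w => w g) (fun g => ⟪S c, g⟫) (fun g => τ • g) →
          K ∘ₘ Q = gaussianShift (fun i => s * S' c i) (s * τ) := by
  obtain ⟨A, R, hAR, hA⟩ := exists_partialIsometry fun c => (h c).symm
  let e : Fin n → EuclideanSpace ℝ (Fin n) := fun i => EuclideanSpace.single i 1
  have hT : Measurable fun (ω : (H → ℝ) × (Fin n → ℝ)) (i : Fin n) =>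
      s * ω.1 (A (e i)) + (s * τ) * ∑ j, R (e i) j * ω.2 j :=
    measurable_pi_lambda _ fun i => by fun_prop
  obtain ⟨K, hK, hKP⟩ := exists_markovKernel_comp_eq_map_prod
    (Measure.pi fun _ : Fin n => gaussianReal 0 1) hT
  refine ⟨K, hK, fun c Q _ hQ => ?_⟩
  rw [hKP]
  have h1 := (hQ.comp A).const_add_mul 0 s
  have h2 := ((isGaussianField_pi_gaussianReal n).comp R).const_add_mul 0 (s * τ)
  have h3 := h1.add_prod h2 (χ := fun v => (s * τ) • v) fun e => by
    have e1 := linearCombination_linearMap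
      ((s * τ) • LinearMap.id : EuclideanSpace ℝ (Fin n) →ₗ[ℝ] EuclideanSpace ℝ (Fin n)) e
    have e2 := linearCombination_linearMap (s • τ • A) e
    have e3 := linearCombination_linearMap ((s * τ) • R) e
    simp only [LinearMap.smul_apply, LinearMap.id_apply] at e1 e2 e3
    simp only [id]
    rw [e1, e2, e3, smul_smul, norm_smul, norm_smul, norm_smul, mul_pow, mul_pow, mul_pow, hAR,
      mul_add]
  have h4 := h3.comp e
  have h5 : (fun i => (0 : EuclideanSpace ℝ (Fin n) → ℝ) (e i) + s * ⟪S c, A (e i)⟫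
      + ((0 : EuclideanSpace ℝ (Fin n) → ℝ) (e i)
        + s * τ * (0 : EuclideanSpace ℝ (Fin n) → ℝ) (R (e i)))) = fun i => s * S' c i := by
    ext i
    simp [hA, e, EuclideanSpace.inner_single_right]
  rw [h5] at h4
  have h6 := h4.map_eq (isGaussianField_gaussianShift_eval (fun i => s * S' c i) (s * τ))
  simpa using h6

end Randomization

/-! ### Spherical polynomials and designs -/

section Sphere

variable {d n m L t : ℕ}

theorem sphericalPolynomials_le (d L : ℕ) : sphericalPolynomials d L ≤
    (MvPolynomial.restrictTotalDegree (Fin (d + 1)) ℝ L).map (polyToSphere d) := by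
  refine iSup₂_le fun l hl => Submodule.map_mono fun p hp => ?_
  rw [MvPolynomial.mem_restrictTotalDegree]
  have hp' : p.IsHomogeneous l := hp.1
  exact hp'.totalDegree_le.trans (by simpa [Nat.lt_succ_iff] using hl)

theorem continuous_polyToSphere (p : MvPolynomial (Fin (d + 1)) ℝ) :
    Continuous (polyToSphere d p) := by
  have h : Continuous fun y : UnitSphere d => fun i => (y : EuclideanSpace ℝ (Fin (d + 1))) i := by
    fun_prop
  exact (MvPolynomial.continuous_eval p).comp h

theorem continuous_of_mem_sphericalPolynomials {g : UnitSphere d → ℝ}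
    (hg : g ∈ sphericalPolynomials d L) : Continuous g := by
  obtain ⟨p, -, rfl⟩ := sphericalPolynomials_le d L hg
  exact continuous_polyToSphere p

theorem memLp_of_mem_sphericalPolynomials {g : UnitSphere d → ℝ}
    (hg : g ∈ sphericalPolynomials d L) : MemLp g 2 (sphereMeasure d) := by
  have hc := continuous_of_mem_sphericalPolynomials hg
  obtain ⟨C, hC⟩ := isCompact_univ.exists_bound_of_continuousOn hc.continuousOn
  exact MemLp.of_bound hc.aestronglyMeasurable C (Eventually.of_forall fun y => hC y (Set.mem_univ y))

/-- A function in the space is the restriction of some `p` of degree at most `L`, so the cubature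
formula applies to `p ^ 2`, of degree at most $2L \le t$. -/
theorem IsSphericalDesign.sum_sq_eq {x : Fin n → UnitSphere d} (hx : IsSphericalDesign t x)
    (ht : 2 * L ≤ t) {g : UnitSphere d → ℝ} (hg : g ∈ sphericalPolynomials d L) :
    (1 / (n : ℝ)) * ∑ i, g (x i) ^ 2 = ∫ y, g y ^ 2 ∂sphereMeasure d := by
  obtain ⟨p, hp, rfl⟩ := sphericalPolynomials_le d L hg
  have hp' : p.totalDegree ≤ L := (MvPolynomial.mem_restrictTotalDegree _ _ _).1 hp
  have h1 := hx.cubature (p ^ 2) ((MvPolynomial.totalDegree_pow p 2).trans (by omega))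
  have h2 : ∀ y, polyToSphere d (p ^ 2) y = polyToSphere d p y ^ 2 := fun y => by
    simp [polyToSphere]
  simpa only [h2] using h1

/-- The law of the process `g ↦ ∫ b g dμ + τ ∫ g dW`. -/
noncomputable def whiteNoiseLaw (b : UnitSphere d → ℝ) (τ : ℝ) :
    Measure (Lp ℝ 2 (sphereMeasure d) → ℝ) :=
  (whiteNoise d).map fun w g => (∫ y, b y * g y ∂sphereMeasure d) + τ * w g

theorem measurable_whiteNoise_shift (b : UnitSphere d → ℝ) (τ : ℝ) :
    Measurable fun (w : Lp ℝ 2 (sphereMeasure d) → ℝ) (g : Lp ℝ 2 (sphereMeasure d)) =>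
      (∫ y, b y * g y ∂sphereMeasure d) + τ * w g :=
  measurable_pi_lambda _ fun g => by
    have := measurable_pi_apply (X := fun _ : Lp ℝ 2 (sphereMeasure d) => ℝ) g
    exact (this.const_mul τ).const_add _

instance isProbabilityMeasure_whiteNoiseLaw (b : UnitSphere d → ℝ) (τ : ℝ) :
    IsProbabilityMeasure (whiteNoiseLaw b τ) :=
  Measure.isProbabilityMeasure_map (measurable_whiteNoise_shift b τ).aemeasurable

theorem isGaussianField_whiteNoiseLaw {b : UnitSphere d → ℝ} (τ : ℝ)
    (hb : MemLp b 2 (sphereMeasure d)) :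
    IsGaussianField (whiteNoiseLaw b τ) (fun g w => w g) (fun g => ⟪hb.toLp, g⟫)
      (fun g => τ • g) := by
  refine IsGaussianField.of_map (measurable_whiteNoise_shift b τ)
    (fun g => measurable_pi_apply g) ?_
  have h := (isIsonormalLaw_whiteNoise d).isGaussianField.const_add_mul
    (fun g => ∫ y, b y * g y ∂sphereMeasure d) τ
  have h1 : ∀ g : Lp ℝ 2 (sphereMeasure d), ∫ y, b y * g y ∂sphereMeasure d = ⟪hb.toLp, g⟫ :=
    fun g => by
      rw [L2.inner_def]
      refine integral_congr_ae ?_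
      filter_upwards [hb.coeFn_toLp] with y hy
      rw [hy]
      simp [mul_comm]
  simp only [Pi.zero_apply, mul_zero, add_zero, id, h1] at h ⊢
  exact h

/-- The upper bound is sufficiency with $u = v/\tau$, where $v$ is the difference of the drifts. It
is attained by testing the process at $g = v/(\tau\|v\|)$, where the noise has unit variance. -/
theorem tvDist_whiteNoiseLaw {b b' : UnitSphere d → ℝ} {τ : ℝ} (hτ : 0 < τ)
    (hb : MemLp b 2 (sphereMeasure d)) (hb' : MemLp b' 2 (sphereMeasure d)) :
    tvDist (whiteNoiseLaw b τ) (whiteNoiseLaw b' τ)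
      = oneSubTwoCDF (ENNReal.ofReal (1 / (2 * τ))
        * eLpNorm (fun y => b y - b' y) 2 (sphereMeasure d)) := by
  have hP := isGaussianField_whiteNoiseLaw τ hb
  have hQ := isGaussianField_whiteNoiseLaw τ hb'
  obtain ⟨v, hv⟩ : ∃ v, v = hb.toLp - hb'.toLp := ⟨_, rfl⟩
  have hvn : eLpNorm (fun y => b y - b' y) 2 (sphereMeasure d) = ENNReal.ofReal ‖v‖ := by
    rw [hv, ← MemLp.toLp_sub, Lp.norm_toLp, ENNReal.ofReal_toReal (hb.sub hb').eLpNorm_ne_top]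
    rfl
  have hu : ‖τ⁻¹ • v‖ / 2 = 1 / (2 * τ) * ‖v‖ := by
    simp only [norm_smul, norm_inv, Real.norm_eq_abs, abs_of_pos hτ]
    field_simp
  rw [hvn, ← ENNReal.ofReal_mul (by positivity), ← hu, ← tvDist_gaussianReal_neg (by positivity)]
  refine le_antisymm (tvDist_le_of_isGaussianField hP hQ fun g => ?_) ?_
  · rw [inner_smul_left, inner_smul_right, hv, inner_sub_left, conj_trivial,
      inv_mul_cancel_left₀ hτ.ne']
  rcases eq_or_ne v 0 with h0 | h0
  · simp [h0, tvDist_self]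
  have hv0 : 0 < ‖v‖ := norm_pos_iff.2 h0
  have h1 := le_tvDist_of_isGaussianField hP hQ (t := τ⁻¹ • ‖v‖⁻¹ • v) (by
    rw [smul_smul, mul_inv_cancel₀ hτ.ne', one_smul, norm_smul, norm_inv, norm_norm,
      inv_mul_cancel₀ hv0.ne'])
  have h2 : τ⁻¹ * (‖v‖⁻¹ * ‖v‖ ^ 2) = ‖τ⁻¹ • v‖ := by
    rw [norm_smul, norm_inv, Real.norm_eq_abs, abs_of_pos hτ]
    field_simp
  rwa [← inner_sub_left, ← hv, inner_smul_right, inner_smul_right, real_inner_self_eq_norm_sq,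
    h2] at h1

/-- White noise with drift $\tilde f_m$ is exactly equivalent to the Gaussian vector with means
$\tilde f_m(x_i)$, so only the distance between that vector and the regression data remains. -/
theorem leCamDist_regression_le {x : Fin n → UnitSphere d} {ψ : Fin m → UnitSphere d → ℝ}
    {σ : ℝ} (Θ : Set (UnitSphere d → ℝ)) (hσ : 0 < σ)
    (hψ : Submodule.span ℝ (Set.range ψ) ≤ sphericalPolynomials d L)
    (hx : IsSphericalDesign t x) (ht : 2 * L ≤ t) :
    leCamDist (regressionExperiment Θ x σ)
        (whiteNoiseExperiment Θ (empApprox x ψ) (σ / √(n : ℝ)))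
      ≤ ⨆ f : Θ, tvDist (gaussianShift (fun i => empApprox x ψ f (x i)) σ)
        (gaussianShift (fun i => (f : UnitSphere d → ℝ) (x i)) σ) := by
  have hn : (0 : ℝ) < n := Nat.cast_pos.2 hx.nonempty
  have hs : 0 < √(n : ℝ) := Real.sqrt_pos.2 hn
  have hmem : ∀ j, ψ j ∈ sphericalPolynomials d L := fun j =>
    hψ (Submodule.subset_span ⟨j, rfl⟩)
  have hmem' : ∀ c : Fin m → ℝ, (fun y => ∑ j, c j * ψ j y) ∈ sphericalPolynomials d L := fun c => by
    have : (fun y => ∑ j, c j * ψ j y) = ∑ j, c j • ψ j := by ext y; simp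
    rw [this]
    exact Submodule.sum_mem _ fun j _ => Submodule.smul_mem _ _ (hmem j)
  have hLp : ∀ c : Fin m → ℝ, MemLp (fun y => ∑ j, c j * ψ j y) 2 (sphereMeasure d) := fun c =>
    memLp_of_mem_sphericalPolynomials (hmem' c)
  let S : (Fin m → ℝ) →ₗ[ℝ] Lp ℝ 2 (sphereMeasure d) :=
    { toFun := fun c => (hLp c).toLp
      map_add' := fun c c' => by
        rw [← MemLp.toLp_add]
        congr 1
        ext y; simp [add_mul, Finset.sum_add_distrib]
      map_smul' := fun a c => by
        rw [RingHom.id_apply, ← MemLp.toLp_const_smul]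
        congr 1
        ext y; simp [mul_assoc, Finset.mul_sum] }
  -- The factor $n^{-1/2}$ makes `‖S' c‖` the empirical norm, which the design identifies with the
  -- $L^2$ norm `‖S c‖`. It is undone by the scale $s = \sqrt n$ in the kernels, which also turns
  -- noise level $\sigma/\sqrt n$ into $\sigma$.
  let S' : (Fin m → ℝ) →ₗ[ℝ] EuclideanSpace ℝ (Fin n) :=
    { toFun := fun c => WithLp.toLp 2 fun i => (√(n : ℝ))⁻¹ * ∑ j, c j * ψ j (x i)
      map_add' := fun c c' => by
        ext i; simp [add_mul, mul_add, Finset.sum_add_distrib]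
      map_smul' := fun a c => by
        ext i; simp only [Pi.smul_apply, smul_eq_mul, mul_assoc, ← Finset.mul_sum, PiLp.smul_apply,
          RingHom.id_apply]
        ring }
  have hSS : ∀ c, ‖S c‖ = ‖S' c‖ := fun c => by
    have h1 : ‖S c‖ ^ 2 = ∫ y, (∑ j, c j * ψ j y) ^ 2 ∂sphereMeasure d := by
      rw [← real_inner_self_eq_norm_sq, L2.inner_def]
      refine integral_congr_ae ?_
      filter_upwards [(hLp c).coeFn_toLp] with y hy
      simp only [S, LinearMap.coe_mk, AddHom.coe_mk, hy]
      simp [pow_two]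
    have h2 : ‖S' c‖ ^ 2 = (1 / (n : ℝ)) * ∑ i, (∑ j, c j * ψ j (x i)) ^ 2 := by
      rw [EuclideanSpace.norm_sq_eq, Finset.mul_sum]
      refine Finset.sum_congr rfl fun i _ => ?_
      simp only [S', LinearMap.coe_mk, AddHom.coe_mk, Real.norm_eq_abs, sq_abs, mul_pow, inv_pow,
        Real.sq_sqrt hn.le, one_div]
    have h3 : ‖S c‖ ^ 2 = ‖S' c‖ ^ 2 := by
      rw [h1, h2]
      exact (hx.sum_sq_eq ht (hmem' c)).symm
    exact (sq_eq_sq₀ (norm_nonneg _) (norm_nonneg _)).1 h3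
  have hτ : √(n : ℝ) * (σ / √(n : ℝ)) = σ := by field_simp
  have hS' : ∀ f : Θ, (fun i => √(n : ℝ) * S' (fun j => empInner x f (ψ j)) i)
      = fun i => empApprox x ψ f (x i) := fun f => by
    ext i
    simp only [S', LinearMap.coe_mk, AddHom.coe_mk, mul_inv_cancel_left₀ hs.ne', empApprox]
  have hG : ∀ f : Θ, IsGaussianField (whiteNoiseLaw (empApprox x ψ f) (σ / √(n : ℝ))) (fun g w => w g)
      (fun g => ⟪S fun j => empInner x f (ψ j), g⟫) (fun g => (σ / √(n : ℝ)) • g) := fun f =>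
    isGaussianField_whiteNoiseLaw _ (hLp _)
  obtain ⟨K, hK, hKP⟩ := exists_kernel_gaussianShift_to_isonormal (τ := σ / √(n : ℝ)) hSS hs
  obtain ⟨K', hK', hKP'⟩ := exists_kernel_isonormal_to_gaussianShift (s := √(n : ℝ))
    (τ := σ / √(n : ℝ)) hSS
  rw [hτ] at hKP hKP'
  refine max_le ?_ ?_
  · refine (deficiency_le_iSup (fun f : Θ => gaussianShift (fun i => f.1 (x i)) σ)
      (fun f : Θ => whiteNoiseLaw (empApprox x ψ f) (σ / √(n : ℝ))) K).trans
      (iSup_mono fun f => ?_)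
    have h1 := hKP _ _ (hG f)
    rw [hS'] at h1
    rw [← h1, tvDist_comm]
    exact tvDist_comp_le K _ _
  · refine (deficiency_le_iSup (fun f : Θ => whiteNoiseLaw (empApprox x ψ f) (σ / √(n : ℝ)))
      (fun f : Θ => gaussianShift (fun i => f.1 (x i)) σ) K').trans (iSup_mono fun f => ?_)
    rw [hKP' _ _ (hG f), hS']

end Sphere

/-! ### The main theorem -/

theorem mainTheorem1 :
    ∃ C : ℝ≥0, ∀ (d n m L t : ℕ) (σ : ℝ) (Θ : Set (UnitSphere d → ℝ))
      (x : Fin n → UnitSphere d) (ψ : Fin m → UnitSphere d → ℝ),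
      0 < σ →
      (∀ f ∈ Θ, MemLp f 2 (sphereMeasure d)) →
      Submodule.span ℝ (Set.range ψ) ≤ sphericalPolynomials d L →
      IsSphericalDesign t x →
      2 * L ≤ t →
      let F := regressionExperiment Θ x σ
      let G := whiteNoiseExperiment Θ (fun f => f) (σ / √(n : ℝ))
      let G' := whiteNoiseExperiment Θ (empApprox x ψ) (σ / √(n : ℝ))
      let S₁ : ℝ≥0∞ :=
        ⨆ f ∈ Θ, ENNReal.ofReal (∑ i, (empApprox x ψ f (x i) - f (x i)) ^ 2)
      let S₂ : ℝ≥0∞ :=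
        ⨆ f ∈ Θ, eLpNorm (fun y => f y - empApprox x ψ f y) 2 (sphereMeasure d)
      leCamDist F G ≤ leCamDist F G' + leCamDist G' G ∧
      leCamDist F G' ≤ oneSubTwoCDF (ENNReal.ofReal (1 / (2 * σ)) * S₁ ^ (1 / 2 : ℝ)) ∧
      oneSubTwoCDF (ENNReal.ofReal (1 / (2 * σ)) * S₁ ^ (1 / 2 : ℝ)) ≤
        C * ENNReal.ofReal σ⁻¹ *
          ⨆ f ∈ Θ, ENNReal.ofReal √(∑ i, (empApprox x ψ f (x i) - f (x i)) ^ 2) ∧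
      leCamDist G' G ≤ ⨆ f : Θ, tvDist (G'.law f) (G.law f) ∧
      (⨆ f : Θ, tvDist (G'.law f) (G.law f)) =
        oneSubTwoCDF (ENNReal.ofReal (√(n : ℝ) / (2 * σ)) * S₂) ∧
      oneSubTwoCDF (ENNReal.ofReal (√(n : ℝ) / (2 * σ)) * S₂) ≤
        C * ENNReal.ofReal σ⁻¹ * ENNReal.ofReal √(n : ℝ) * S₂ := by
  -- $C = 1$ suffices: the factor $2$ in `oneSubTwoCDF_le` cancels the $1/2$ in the arguments.
  refine ⟨1, fun d n m L t σ Θ x ψ hσ hΘ hψ hx ht => ?_⟩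
  intro F G G' S₁ S₂
  have hn : (0 : ℝ) < n := Nat.cast_pos.2 hx.nonempty
  have hs : 0 < √(n : ℝ) := Real.sqrt_pos.2 hn
  -- The square root is an order isomorphism of $[0,\infty]$, so it passes through the supremum.
  have hsqrt : S₁ ^ (1 / 2 : ℝ)
      = ⨆ f ∈ Θ, ENNReal.ofReal √(∑ i, (empApprox x ψ f (x i) - f (x i)) ^ 2) := by
    have h1 : ∀ f : UnitSphere d → ℝ, ENNReal.ofReal √(∑ i, (empApprox x ψ f (x i) - f (x i)) ^ 2)
        = ENNReal.orderIsoRpow (1 / 2) (by norm_num)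
          (ENNReal.ofReal (∑ i, (empApprox x ψ f (x i) - f (x i)) ^ 2)) := fun f => by
      rw [Real.sqrt_eq_rpow, ENNReal.orderIsoRpow_apply,
        ENNReal.ofReal_rpow_of_nonneg (Finset.sum_nonneg fun i _ => sq_nonneg _) (by norm_num)]
    simp only [h1, S₁, ← OrderIso.map_iSup]
    rfl
  refine ⟨leCamDist_triangle F G' G, ?_, ?_, leCamDist_le_iSup_tvDist
    (fun f : Θ => whiteNoiseLaw (empApprox x ψ f) (σ / √(n : ℝ)))
    (fun f : Θ => whiteNoiseLaw f (σ / √(n : ℝ))), ?_, ?_⟩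
  · refine (leCamDist_regression_le Θ hσ hψ hx ht).trans (iSup_le fun f => ?_)
    refine (tvDist_gaussianShift_le _ _ hσ).trans (oneSubTwoCDF_mono ?_)
    rw [ENNReal.ofReal_mul (by positivity), hsqrt]
    gcongr
    exact le_iSup₂_of_le (f : UnitSphere d → ℝ) f.2 le_rfl
  · rw [hsqrt]
    refine (oneSubTwoCDF_le _).trans ?_
    rw [← mul_assoc, ← ENNReal.ofReal_ofNat, ← ENNReal.ofReal_mul zero_le_two]
    have : 2 * (1 / (2 * σ)) = σ⁻¹ := by field_simp
    rw [this, ENNReal.coe_one, one_mul]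
  · have h1 : ∀ f : Θ, MemLp (empApprox x ψ f) 2 (sphereMeasure d) := fun f => by
      refine memLp_of_mem_sphericalPolynomials (L := L) (hψ ?_)
      have : empApprox x ψ f = ∑ j, empInner x f (ψ j) • ψ j := by ext y; simp [empApprox]
      rw [this]
      exact Submodule.sum_mem _ fun j _ =>
        Submodule.smul_mem _ _ (Submodule.subset_span ⟨j, rfl⟩)
    have h2 : ∀ f : Θ, tvDist (G'.law f) (G.law f)
        = oneSubTwoCDF (ENNReal.ofReal (√(n : ℝ) / (2 * σ))
          * eLpNorm (fun y => (f : UnitSphere d → ℝ) y - empApprox x ψ f y) 2 (sphereMeasure d)) := by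
      intro f
      refine (tvDist_comm (whiteNoiseLaw (empApprox x ψ f) (σ / √(n : ℝ)))
        (whiteNoiseLaw f (σ / √(n : ℝ)))).trans ?_
      rw [tvDist_whiteNoiseLaw (div_pos hσ hs) (hΘ f f.2) (h1 f)]
      congr 3
      field_simp
    -- Equality survives the supremum over `f` because `oneSubTwoCDF` commutes with suprema,
    -- infinite or empty ones included.
    rw [iSup_congr h2, ← oneSubTwoCDF_iSup, ← ENNReal.mul_iSup]
    simp only [S₂, iSup_subtype]
  · refine (oneSubTwoCDF_le _).trans ?_
    rw [← mul_assoc, ← ENNReal.ofReal_ofNat, ← ENNReal.ofReal_mul zero_le_two, ENNReal.coe_one,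
      one_mul, ← ENNReal.ofReal_mul (by positivity)]
    have : 2 * (√(n : ℝ) / (2 * σ)) = σ⁻¹ * √(n : ℝ) := by field_simp
    rw [this]
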